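/- **Terminology.** A *cellular stratification* of a Hausdorff space $X$ consists of a surjection $\pi:X\to P$ onto a poset whose strata $e_\lambda=\pi^{-1}(\lambda)$ are connected and locally closed and satisfy $\lambda\le\mu\iff e_\lambda\subset\overline{e_\mu}$, together with, for every $\lambda$, a set $\mathrm{Int}\,D^{k}\subset D_\lambda\subset D^{k}$ (where $k=\dim e_\lambda$) and a continuous map $\varphi_\lambda:D_\lambda\to X$ which is a quotient map onto $\overline{e_\lambda}$ and restricts to a homeomorphism $\mathrm{Int}\,D^k\to e_\lambda$, such that $\overline{e_\lambda}\setminus e_\lambda$ is covered by finitely many cells of dimension $<k$. It is *regular* if every $\varphi_\lambda$ is a homeomorphism onto $\overline{e_\lambda}$. A *regular cell decomposition* is a regular cellular stratification with all $D_\lambda=D^{\dim e_\lambda}$ that is closure finite and has the weak topology with respect to the closures of its cells. A subspace $L\subset X$ with its own regular cellular stratification is a *stratified subspace* of $X$ if the inclusion is a strict morphism: it sends each stratum of $L$ onto a stratum of $X$, compatibly with an order preserving map $f$ of face posets, and for each cell $e_\lambda$ of $L$ it is covered by a continuous map $D_\lambda\to D_{f(\lambda)}$ of domains that commutes with the characteristic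 maps and takes $0$ to $0$ (for example, $L$ is a union of cells with the restricted characteristic maps $\varphi_\lambda|_{\varphi_\lambda^{-1}(L)}$). The *face category* $C(X)$ has the cells as objects and, as morphisms $e_\mu\to e_\lambda$, the continuous maps $b:D_\mu\to D_\lambda$ with $\varphi_\lambda\circ b=\varphi_\mu$. The *barycentric subdivision* $\mathrm{Sd}(X)$ is the classifying space of $C(X)$. The canonical map $i_X:\mathrm{Sd}(X)\to X$ is $\varphi_{\lambda_k}\circ z$ on the simplex of a chain $e_{\lambda_0}\xrightarrow{b_1}\cdots\xrightarrow{b_k}e_{\lambda_k}$, where $z:\Delta^k\to D_{\lambda_k}$ is defined inductively: $z=0$ if $k=0$; and $z\big((1-s)u+s\,v_k\big)=(1-s)\,b_k(z'(u))$ for $u\in\Delta^{k-1}$, $0\le s\le 1$, where $v_k$ is the last vertex of $\Delta^k$ and $z'$ is the map for the chain ending at $e_{\lambda_{k-1}}$. A *deformation retraction* of $X$ onto $A\subset X$ is a continuous map $H:X\times[0,1]\to X$ with $H(x,0)=x$ and $H(x,1)\in A$ for all $x\in X$, and $H(a,1)=a$ for all $a\in A$. It is *strong* if $H(a,s)=a$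 for all $a\in A$ and $s\in[0,1]$. **Theorem.** Let $n\ge 0$, let $\pi$ be a regular cell decomposition of $S^{n-1}\subset\mathbb{R}^n$, and let $L\subset S^{n-1}$ be a stratified subspace. Give $K=\mathrm{Int}\,D^n\cup L$ the cellular stratification whose cells are those of $L$ together with the $n$-cell $\mathrm{Int}\,D^n$, which has domain $K$ and the identity of $K$ as characteristic map. Then there is a strong deformation retraction of $K$ onto $i_K(\mathrm{Sd}(K))$. Furthermore, every deformation retraction $h$ of $L$ onto $i_L(\mathrm{Sd}(L))$ extends to a deformation retraction $H$ of $K$ onto $i_K(\mathrm{Sd}(K))$, that is, $H(y,s)=h(y,s)$ for all $y\in L$ and $s\in[0,1]$; and if $h$ is strong, then $H$ can be taken to be strong. -/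

import Mathlib

open CategoryTheory

/-- A `k`-dimensional cell of a space `X`: a domain `D` with `Int D^k ⊆ D ⊆ D^k` and a continuous
characteristic map `D → X`. -/
structure StratCell (X : Type) [TopologicalSpace X] where
  dim : ℕ
  domain : Set (EuclideanSpace ℝ (Fin dim))
  ball_subset : Metric.ball 0 1 ⊆ domain
  subset_closedBall : domain ⊆ Metric.closedBall 0 1
  char : C(domain, X)

/-- The data of a cellular stratification of `X` with cells indexed by `Λ`: the map `π : X → Λ` and
one cell for each index. The axioms are in `CellStructure.IsCellularStratification`. -/
structure CellStructure (X Λ : Type) [TopologicalSpace X] where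
  strat : X → Λ
  cell : Λ → StratCell X

namespace StratCell

variable {X : Type} [TopologicalSpace X]

/-- The centre `0` of the domain of a cell. -/
def origin (c : StratCell X) : c.domain :=
  ⟨0, c.ball_subset (by simp)⟩

/-- The open unit ball, as a set of points of the domain of a cell. -/
def interior (c : StratCell X) : Set c.domain :=
  {x | (x : EuclideanSpace ℝ (Fin c.dim)) ∈ Metric.ball 0 1}

/-- Radial contraction `x ↦ r x`, `0 ≤ r ≤ 1`, of the domain of a cell. -/
def scale (c : StratCell X) (r : unitInterval) (x : c.domain) : c.domain :=
  ⟨(r : ℝ) • (x : EuclideanSpace ℝ (Fin c.dim)), by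
    have hx : ‖(x : EuclideanSpace ℝ (Fin c.dim))‖ ≤ 1 := by
      simpa using c.subset_closedBall x.2
    rcases eq_or_lt_of_le r.2.2 with h | h
    · rw [h, one_smul]; exact x.2
    · apply c.ball_subset
      rw [mem_ball_zero_iff, norm_smul, Real.norm_of_nonneg r.2.1]
      calc (r : ℝ) * ‖(x : EuclideanSpace ℝ (Fin c.dim))‖ ≤ (r : ℝ) * 1 := by
            gcongr
            exact r.2.1
        _ < 1 := by simpa using h⟩

/-- A morphism of cells: a lift of the characteristic map of `c` along that of `d`. -/
@[ext]
structure Lift (c d : StratCell X) where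
  map : C(c.domain, d.domain)
  comm : ∀ x, d.char (map x) = c.char x

end StratCell

namespace CellStructure

variable {X Λ : Type} [TopologicalSpace X]

/-- The stratum `e_l = π⁻¹(l)`. -/
def stratum (σ : CellStructure X Λ) (l : Λ) : Set X :=
  σ.strat ⁻¹' {l}

/-- `σ` is a cellular stratification of the Hausdorff space `X`, with face poset `Λ`. -/
structure IsCellularStratification [PartialOrder Λ] (σ : CellStructure X Λ) : Prop where
  t2 : T2Space X
  le_iff : ∀ l m, l ≤ m ↔ σ.stratum l ⊆ closure (σ.stratum m)
  connected : ∀ l, IsConnected (σ.stratum l)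
  locallyClosed : ∀ l, IsLocallyClosed (σ.stratum l)
  range_char : ∀ l, Set.range (σ.cell l).char = closure (σ.stratum l)
  quotient_char : ∀ l, Topology.IsQuotientMap (Set.rangeFactorization (σ.cell l).char)
  image_interior : ∀ l, (σ.cell l).char '' (σ.cell l).interior = σ.stratum l
  embedding_interior : ∀ l,
    Topology.IsEmbedding fun x : (σ.cell l).interior => (σ.cell l).char x
  boundary : ∀ l, ∃ F : Finset Λ, (∀ m ∈ F, (σ.cell m).dim < (σ.cell l).dim) ∧
    closure (σ.stratum l) \ σ.stratum l ⊆ ⋃ m ∈ F, σ.stratum m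

/-- Regularity: every characteristic map is a homeomorphism onto its image (which is the closure
of the stratum). -/
def IsRegular (σ : CellStructure X Λ) : Prop :=
  ∀ l, Topology.IsEmbedding (σ.cell l).char

/-- The CW condition: closure finiteness and the weak topology. -/
structure IsCW (σ : CellStructure X Λ) : Prop where
  closureFinite : ∀ l, ∃ F : Finset Λ,
    closure (σ.stratum l) \ σ.stratum l ⊆ ⋃ m ∈ F, σ.stratum m
  weakTopology : ∀ A : Set X, (∀ l, IsClosed (A ∩ closure (σ.stratum l))) → IsClosed A

/-- A regular cell complex (regular cell decomposition): a regular CW cellular stratification in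
which the domain of every cell is the whole closed disk. -/
structure IsRegularCellComplex [PartialOrder Λ] (σ : CellStructure X Λ) : Prop where
  isCellularStratification : σ.IsCellularStratification
  isRegular : σ.IsRegular
  isCW : σ.IsCW
  domain_eq : ∀ l, (σ.cell l).domain = Metric.closedBall 0 1

/-- The inclusion of a subspace `L ⊆ X`, with cell structure `τ`, is a strict morphism of cellular
stratified spaces into `(X, σ)`: it maps each stratum onto a stratum compatibly with a map of face
posets, and is covered by maps of domains that preserve the centres. -/
def IsStratifiedSubspace {M : Type} [PartialOrder Λ] [PartialOrder M] {L : Set X}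
    (τ : CellStructure L M) (σ : CellStructure X Λ) : Prop :=
  ∃ f : M →o Λ,
    (∀ y : L, σ.strat y = f (τ.strat y)) ∧
    (∀ m, Subtype.val '' τ.stratum m = σ.stratum (f m)) ∧
    ∀ m, ∃ g : C((τ.cell m).domain, (σ.cell (f m)).domain),
      (∀ x, (σ.cell (f m)).char (g x) = ((τ.cell m).char x : X)) ∧
      g (τ.cell m).origin = (σ.cell (f m)).origin

/-- The face category: objects are the cells, morphisms are the lifts of characteristic maps. -/
@[ext]
structure FaceCategory (σ : CellStructure X Λ) where
  idx : Λ

instance (σ : CellStructure X Λ) : Category σ.FaceCategory where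
  Hom a b := StratCell.Lift (σ.cell a.idx) (σ.cell b.idx)
  id a := ⟨ContinuousMap.id _, fun _ => rfl⟩
  comp f g := ⟨g.map.comp f.map, fun x => (g.comm _).trans (f.comm x)⟩

/-- The barycentric subdivision: the classifying space of the face category. -/
noncomputable def Sd (σ : CellStructure X Λ) : TopCat.{0} :=
  SSet.toTop.obj (nerve σ.FaceCategory)

section Embedding

variable (σ : CellStructure X Λ) {k : ℕ}

/-- The sum `t₀ + ⋯ + t_j` of barycentric coordinates. -/
noncomputable def partialSum (t : stdSimplex ℝ (Fin (k + 1))) (j : Fin (k + 1)) : ℝ :=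
  ∑ i ∈ Finset.Iic j, t i

lemma partialSum_nonneg (t : stdSimplex ℝ (Fin (k + 1))) (j : Fin (k + 1)) :
    0 ≤ partialSum t j :=
  Finset.sum_nonneg fun i _ => stdSimplex.zero_le t i

lemma partialSum_mono (t : stdSimplex ℝ (Fin (k + 1))) : Monotone (partialSum t) := fun _ _ h =>
  Finset.sum_le_sum_of_subset_of_nonneg (Finset.Iic_subset_Iic.2 h)
    fun i _ _ => stdSimplex.zero_le t i

/-- The ratio `(t₀ + ⋯ + t_j) / (t₀ + ⋯ + t_{j+1})`, as an element of `[0,1]`. -/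
noncomputable def ratio (t : stdSimplex ℝ (Fin (k + 1))) (j : Fin k) : unitInterval :=
  ⟨partialSum t j.castSucc / partialSum t j.succ,
    div_nonneg (partialSum_nonneg _ _) (partialSum_nonneg _ _),
    div_le_one_of_le₀ (partialSum_mono t j.castSucc_lt_succ.le) (partialSum_nonneg _ _)⟩

/-- For a chain `e₀ → e₁ → ⋯ → e_k` of the face category and barycentric coordinates `t`, the point
`z_j` of the domain of `e_j` determined by the truncated chain `e₀ → ⋯ → e_j` and the coordinates
`(t₀, …, t_j)` rescaled to sum `1`. One has `z₀ = 0`, and `z_{j+1}` is the point of the segment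
from `b z_j` to the centre `0` (that is, of the join of the boundary with `0`) whose weight at `0`
is the relative weight `t_{j+1} / (t₀ + ⋯ + t_{j+1})` of the last vertex, where `b` is the lift
`e_j → e_{j+1}`. -/
noncomputable def chainPoint (F : ComposableArrows σ.FaceCategory k)
    (t : stdSimplex ℝ (Fin (k + 1))) (j : Fin (k + 1)) : (σ.cell (F.obj j).idx).domain :=
  Fin.induction (motive := fun j => (σ.cell (F.obj j).idx).domain)
    (σ.cell (F.obj 0).idx).origin
    (fun j z => (σ.cell (F.obj j.succ).idx).scale (ratio t j)
      ((F.map (homOfLE j.castSucc_lt_succ.le)).map z)) j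

lemma chainPoint_zero (F : ComposableArrows σ.FaceCategory k) (t : stdSimplex ℝ (Fin (k + 1))) :
    σ.chainPoint F t 0 = (σ.cell (F.obj 0).idx).origin := rfl

lemma chainPoint_succ (F : ComposableArrows σ.FaceCategory k) (t : stdSimplex ℝ (Fin (k + 1)))
    (j : Fin k) :
    σ.chainPoint F t j.succ = (σ.cell (F.obj j.succ).idx).scale (ratio t j)
      ((F.map (homOfLE j.castSucc_lt_succ.le)).map (σ.chainPoint F t j.castSucc)) := rfl

/-- The map `i_k : N_k(C(X)) × Δ^k → X`. -/
noncomputable def simplexMap (F : ComposableArrows σ.FaceCategory k)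
    (t : stdSimplex ℝ (Fin (k + 1))) : X :=
  (σ.cell (F.obj (Fin.last k)).idx).char (σ.chainPoint F t (Fin.last k))

lemma continuous_partialSum (j : Fin (k + 1)) :
    Continuous fun t : stdSimplex ℝ (Fin (k + 1)) => partialSum t j := by
  unfold partialSum
  refine continuous_finsetSum _ fun i _ => ?_
  exact (continuous_apply i).comp continuous_subtype_val

lemma partialSum_last (t : stdSimplex ℝ (Fin (k + 1))) : partialSum t (Fin.last k) = 1 := by
  have h : Finset.Iic (Fin.last k) = Finset.univ := by
    ext i; simp [Fin.le_last]
  rw [partialSum, h]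
  exact stdSimplex.sum_eq_one t

lemma continuousAt_chainPoint (F : ComposableArrows σ.FaceCategory k) (j : Fin (k + 1))
    (t : stdSimplex ℝ (Fin (k + 1))) (ht : 0 < partialSum t j) :
    ContinuousAt (fun s => σ.chainPoint F s j) t := by
  induction j using Fin.induction with
  | zero => exact continuousAt_const
  | succ j ih =>
    have hr : ContinuousAt (fun s => ((ratio s j : unitInterval) : ℝ)) t :=
      (continuous_partialSum _).continuousAt.div (continuous_partialSum _).continuousAt ht.ne'
    rw [Topology.IsInducing.subtypeVal.continuousAt_iff]
    rcases (partialSum_nonneg t j.castSucc).eq_or_lt with h0 | h0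
    · have hz : ((ratio t j : unitInterval) : ℝ) = 0 := by simp [ratio, ← h0]
      have hv : (σ.chainPoint F t j.succ).1 = 0 := by
        rw [chainPoint_succ]; simp [StratCell.scale, hz]
      have hr' : Filter.Tendsto (fun s => ((ratio s j : unitInterval) : ℝ)) (nhds t) (nhds 0) := by
        have := hr.tendsto
        rwa [hz] at this
      rw [ContinuousAt, Function.comp_apply, hv]
      refine squeeze_zero_norm (fun s => ?_) hr'
      rw [Function.comp_apply, chainPoint_succ]
      simp only [StratCell.scale]
      rw [norm_smul, Real.norm_of_nonneg (ratio s j).2.1]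
      refine mul_le_of_le_one_right (ratio s j).2.1 ?_
      simpa using (σ.cell (F.obj j.succ).idx).subset_closedBall
        ((F.map (homOfLE j.castSucc_lt_succ.le)).map (σ.chainPoint F s j.castSucc)).2
    · have h1 := ih h0
      have h2 : ContinuousAt (fun s => (F.map (homOfLE j.castSucc_lt_succ.le)).map
          (σ.chainPoint F s j.castSucc)) t :=
        ContinuousAt.comp (f := fun s => σ.chainPoint F s j.castSucc)
          (map_continuous (F.map (homOfLE j.castSucc_lt_succ.le)).map).continuousAt h1
      exact hr.smul (continuous_subtype_val.continuousAt.comp h2)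

lemma continuous_simplexMap (F : ComposableArrows σ.FaceCategory k) :
    Continuous (σ.simplexMap F) := by
  rw [continuous_iff_continuousAt]
  intro t
  exact ContinuousAt.comp (f := fun s => σ.chainPoint F s (Fin.last k))
    (map_continuous (σ.cell (F.obj (Fin.last k)).idx).char).continuousAt
    (σ.continuousAt_chainPoint F _ t (by rw [partialSum_last]; exact one_pos))

/-- Consecutive vertices with weight `0` only apply the lifts. -/
lemma chainPoint_of_le (F : ComposableArrows σ.FaceCategory k) (t : stdSimplex ℝ (Fin (k + 1)))
    {a b : Fin (k + 1)} (h : a ≤ b) (hs : partialSum t a = partialSum t b)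
    (h0 : 0 < partialSum t a) :
    σ.chainPoint F t b = (F.map (homOfLE h)).map (σ.chainPoint F t a) := by
  induction b using Fin.induction with
  | zero =>
    obtain rfl : a = 0 := Fin.le_zero_iff.1 h
    rw [show homOfLE h = 𝟙 _ from rfl, F.map_id]
    rfl
  | succ b ih =>
    rcases h.eq_or_lt with rfl | h'
    · rw [show homOfLE h = 𝟙 _ from rfl, F.map_id]
      rfl
    · have hab : a ≤ b.castSucc := Fin.le_castSucc_iff.2 h'
      have hs' : partialSum t a = partialSum t b.castSucc :=
        le_antisymm (partialSum_mono t hab)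
          (hs ▸ partialSum_mono t b.castSucc_lt_succ.le)
      have hr : ((ratio t b : unitInterval) : ℝ) = 1 := by
        simp only [ratio, ← hs', ← hs]
        exact div_self h0.ne'
      rw [chainPoint_succ, ih hab hs',
        show homOfLE h = homOfLE hab ≫ homOfLE b.castSucc_lt_succ.le from rfl, F.map_comp]
      apply Subtype.ext
      simp only [StratCell.scale, hr, one_smul]
      rfl

lemma chainPoint_step (F : ComposableArrows σ.FaceCategory k) (t : stdSimplex ℝ (Fin (k + 1)))
    {a b : Fin (k + 1)} (h : a < b)
    (hs : ∀ c, a ≤ c → c < b → partialSum t c = partialSum t a) :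
    partialSum t b • (σ.chainPoint F t b).1 =
      partialSum t a • ((F.map (homOfLE h.le)).map (σ.chainPoint F t a)).1 := by
  obtain ⟨c, rfl⟩ := Fin.exists_succ_eq.2 (Fin.ne_zero_of_lt h)
  have hac : a ≤ c.castSucc := Fin.le_castSucc_iff.2 h
  have hc := hs _ hac c.castSucc_lt_succ
  have hle := partialSum_mono t c.castSucc_lt_succ.le
  rw [chainPoint_succ]
  simp only [StratCell.scale, ratio, smul_smul]
  rcases (partialSum_nonneg t a).eq_or_lt with h0 | h0
  · rw [hc, ← h0]; simp
  · rw [mul_div_cancel₀ _ (by linarith), hc, σ.chainPoint_of_le F t hac hc.symm h0,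
      show homOfLE h.le = homOfLE hac ≫ homOfLE c.castSucc_lt_succ.le from rfl, F.map_comp]
    rfl

lemma chainPoint_bot (F : ComposableArrows σ.FaceCategory k) (t : stdSimplex ℝ (Fin (k + 1)))
    {b : Fin (k + 1)} (hs : ∀ c, c < b → partialSum t c = 0) :
    (σ.chainPoint F t b).1 = 0 := by
  rcases Fin.eq_zero_or_eq_succ b with rfl | ⟨c, rfl⟩
  · rfl
  · rw [chainPoint_succ]
    simp [StratCell.scale, ratio, hs _ c.castSucc_lt_succ]

lemma partialSum_map {m : ℕ} (θ : Fin (m + 1) →o Fin (k + 1)) (t : stdSimplex ℝ (Fin (m + 1)))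
    (c : Fin (k + 1)) :
    partialSum (stdSimplex.map θ t) c = ∑ i with θ i ≤ c, t i := by
  classical
  have h : ∀ j, (stdSimplex.map θ t) j = ∑ i with θ i = j, t i := fun j => by
    rw [stdSimplex.map_coe, FunOnFinite.linearMap_apply_apply]
  simp only [partialSum, h]
  rw [Finset.sum_sigma']
  refine Finset.sum_bij' (fun x _ => x.2) (fun i _ => ⟨θ i, i⟩) ?_ ?_ ?_ ?_ ?_ <;>
    simp +contextual

lemma partialSum_map_of_iff {m : ℕ} (θ : Fin (m + 1) →o Fin (k + 1))
    (t : stdSimplex ℝ (Fin (m + 1))) (c : Fin (k + 1)) (j : Fin (m + 1))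
    (h : ∀ i, θ i ≤ c ↔ i ≤ j) :
    partialSum (stdSimplex.map θ t) c = partialSum t j := by
  rw [partialSum_map, partialSum]
  congr 1
  ext i
  simp [h]

lemma partialSum_map_of_lt {m : ℕ} (θ : Fin (m + 1) →o Fin (k + 1))
    (t : stdSimplex ℝ (Fin (m + 1))) (c : Fin (k + 1)) (h : ∀ i, c < θ i) :
    partialSum (stdSimplex.map θ t) c = 0 := by
  rw [partialSum_map]
  exact Finset.sum_eq_zero fun i hi => absurd (Finset.mem_filter.1 hi).2 (not_le.2 (h i))

lemma chainPoint_whiskerLeft {m : ℕ} (F : ComposableArrows σ.FaceCategory k)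
    (θ : Fin (m + 1) →o Fin (k + 1)) (t : stdSimplex ℝ (Fin (m + 1))) (j : Fin (m + 1)) :
    partialSum t j • (σ.chainPoint (F.whiskerLeft θ.monotone.functor) t j).1 =
      partialSum (stdSimplex.map θ t) (θ j) •
        (σ.chainPoint F (stdSimplex.map θ t) (θ j)).1 := by
  induction j using Fin.induction with
  | zero =>
    rw [σ.chainPoint_bot F (stdSimplex.map θ t) (b := θ 0), σ.chainPoint_bot (b := 0)]
    · rw [smul_zero]; exact (smul_zero _).symm
    · intro c hc; exact absurd hc (Fin.not_lt_zero c)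
    · intro c hc
      exact partialSum_map_of_lt θ t c fun i => hc.trans_le (θ.monotone (Fin.zero_le i))
  | succ j ih =>
    have hle : θ j.castSucc ≤ θ j.succ := θ.monotone j.castSucc_lt_succ.le
    have h1 : partialSum t j.succ •
        (σ.chainPoint (F.whiskerLeft θ.monotone.functor) t j.succ).1 =
        partialSum t j.castSucc • ((F.map (homOfLE hle)).map
          (σ.chainPoint (F.whiskerLeft θ.monotone.functor) t j.castSucc)).1 := by
      refine σ.chainPoint_step (F.whiskerLeft θ.monotone.functor) t j.castSucc_lt_succ ?_
      intro c hc hc'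
      rw [le_antisymm (Fin.le_castSucc_iff.2 hc') hc]
    rw [h1]
    rcases hle.eq_or_lt with he | hlt
    · have key : ∀ (b : Fin (k + 1)) (hb : θ j.castSucc = b)
          (z : (σ.cell (F.obj (θ j.castSucc)).idx).domain),
          partialSum t j.castSucc • z.1 =
            partialSum (stdSimplex.map θ t) (θ j.castSucc) •
              (σ.chainPoint F (stdSimplex.map θ t) (θ j.castSucc)).1 →
          partialSum t j.castSucc • ((F.map (homOfLE hb.le)).map z).1 =
            partialSum (stdSimplex.map θ t) b • (σ.chainPoint F (stdSimplex.map θ t) b).1 := by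
        rintro b rfl z hz
        rw [show homOfLE le_rfl = 𝟙 (θ j.castSucc) from rfl, F.map_id]
        exact hz
      exact key _ he _ ih
    · have hiff : ∀ c, θ j.castSucc ≤ c → c < θ j.succ → ∀ i, θ i ≤ c ↔ i ≤ j.castSucc := by
        intro c hc hc' i
        refine ⟨fun hi => ?_, fun hi => (θ.monotone hi).trans hc⟩
        rw [Fin.le_castSucc_iff]
        by_contra hn
        exact absurd (θ.monotone (not_lt.1 hn)) (not_le.2 (hi.trans_lt hc'))
      have hsum : ∀ c, θ j.castSucc ≤ c → c < θ j.succ →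
          partialSum (stdSimplex.map θ t) c = partialSum t j.castSucc := fun c hc hc' =>
        partialSum_map_of_iff θ t c _ (hiff c hc hc')
      rw [σ.chainPoint_step F (stdSimplex.map θ t) hlt
        (fun c hc hc' => (hsum c hc hc').trans (hsum _ le_rfl hlt).symm)]
      rw [hsum _ le_rfl hlt] at ih ⊢
      rcases (partialSum_nonneg t j.castSucc).eq_or_lt with h0 | h0
      · rw [← h0, zero_smul, zero_smul]
      · have hz := Subtype.ext (smul_right_injective _ h0.ne' ih)
        rw [← hz]

/-- Compatibility of the maps `i_k` with the simplicial operators. -/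
lemma simplexMap_whiskerLeft {m : ℕ} (F : ComposableArrows σ.FaceCategory k)
    (θ : Fin (m + 1) →o Fin (k + 1)) (t : stdSimplex ℝ (Fin (m + 1))) :
    σ.simplexMap (F.whiskerLeft θ.monotone.functor) t = σ.simplexMap F (stdSimplex.map θ t) := by
  have hl : partialSum (stdSimplex.map θ t) (θ (Fin.last m)) = 1 := by
    rw [partialSum_map_of_iff θ t _ (Fin.last m), partialSum_last]
    intro i
    simp [Fin.le_last, θ.monotone (Fin.le_last i)]
  have h := σ.chainPoint_whiskerLeft F θ t (Fin.last m)
  rw [partialSum_last, hl, one_smul, one_smul] at h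
  have hz : σ.chainPoint (F.whiskerLeft θ.monotone.functor) t (Fin.last m) =
      σ.chainPoint F (stdSimplex.map θ t) (θ (Fin.last m)) := Subtype.ext h
  unfold simplexMap
  rw [hz, σ.chainPoint_of_le F (stdSimplex.map θ t) (Fin.le_last (θ (Fin.last m)))
    (by rw [hl, partialSum_last]) (by rw [hl]; exact one_pos), StratCell.Lift.comm]
  rfl

/-- The simplicial map `N(C(X)) → Sing X` formed by the maps `i_k`. -/
noncomputable def toSing : nerve σ.FaceCategory ⟶ TopCat.toSSet.obj (TopCat.of X) where
  app Δ := ↾fun F => (TopCat.toSSetObjEquiv (TopCat.of X) Δ).symm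
    ⟨σ.simplexMap F, σ.continuous_simplexMap F⟩
  naturality Δ Δ' f := by
    ext F
    apply (TopCat.toSSetObjEquiv (TopCat.of X) Δ').injective
    ext t
    exact σ.simplexMap_whiskerLeft F f.unop.toOrderHom t

/-- The canonical map `i_X : Sd(X) → X`, which restricts to `i_k` on each simplex of `Sd(X)`. -/
noncomputable def sdMap : C(σ.Sd, X) :=
  ((sSetTopAdj.homEquiv (nerve σ.FaceCategory) (TopCat.of X)).symm σ.toSing).hom

/-- The image of `i_X` is the union of the images of the maps `i_k`. -/
lemma range_sdMap :
    Set.range σ.sdMap =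
      {x | ∃ (m : ℕ) (F : ComposableArrows σ.FaceCategory m) (t : stdSimplex ℝ (Fin (m + 1))),
        σ.simplexMap F t = x} := by
  let pt : ∀ (m : ℕ) (_ : ComposableArrows σ.FaceCategory m)
      (_ : stdSimplex ℝ (Fin (m + 1))), σ.Sd := fun m F t =>
    TopCat.toSSetObjEquiv _ _
      ((sSetTopAdj.unit.app (nerve σ.FaceCategory)).app (Opposite.op (SimplexCategory.mk m)) F) t
  have hpt : ∀ m F t, σ.sdMap (pt m F t) = σ.simplexMap F t := by
    intro m F t
    have h1 : sSetTopAdj.homEquiv (nerve σ.FaceCategory) (TopCat.of X)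
        (TopCat.ofHom σ.sdMap) = σ.toSing := Equiv.apply_symm_apply _ _
    have h2 := congrArg (fun φ => TopCat.toSSetObjEquiv _ _
      (φ.app (Opposite.op (SimplexCategory.mk m)) F) t) h1
    exact h2
  have hsurj : ∀ x : σ.Sd, ∃ m F t, pt m F t = x := by
    let R : Set σ.Sd := {x | ∃ m F t, pt m F t = x}
    let _ : TopologicalSpace Prop := ⊤
    let f : σ.Sd ⟶ TopCat.of Prop := TopCat.ofHom ⟨fun x => x ∈ R, continuous_top⟩
    let g : σ.Sd ⟶ TopCat.of Prop := TopCat.ofHom ⟨fun _ => True, continuous_top⟩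
    have hfg : f = g := by
      apply (sSetTopAdj.homEquiv (nerve σ.FaceCategory) (TopCat.of Prop)).injective
      ext Δ F
      apply (TopCat.toSSetObjEquiv (TopCat.of Prop) Δ).injective
      ext t
      exact iff_of_true (show pt Δ.unop.len F t ∈ R from ⟨_, F, t, rfl⟩) trivial
    intro x
    have := ConcreteCategory.congr_hom hfg x
    exact (Eq.mpr this trivial : x ∈ R)
  ext x
  constructor
  · rintro ⟨y, rfl⟩
    obtain ⟨m, F, t, rfl⟩ := hsurj y
    exact ⟨m, F, t, (hpt m F t).symm⟩
  · rintro ⟨m, F, t, rfl⟩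
    exact ⟨pt m F t, hpt m F t⟩

end Embedding

end CellStructure

/-- `K = Int D^n ∪ L`, as a subset of `ℝ^n`, for a subset `L` of the unit sphere. -/
def ballUnion {n : ℕ} (L : Set (Metric.sphere (0 : EuclideanSpace ℝ (Fin n)) 1)) :
    Set (EuclideanSpace ℝ (Fin n)) :=
  Metric.ball 0 1 ∪ Subtype.val '' L

/-- The inclusion `L → K`. -/
def ballUnionIncl {n : ℕ} (L : Set (Metric.sphere (0 : EuclideanSpace ℝ (Fin n)) 1)) :
    C(L, ballUnion L) where
  toFun y := ⟨y.1.1, Or.inr ⟨y.1, y.2, rfl⟩⟩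

open Classical in
/-- The cellular stratification on `K = Int D^n ∪ L` obtained from that of `L` by adding `Int D^n`
as an `n`-cell, with domain `K` and the identity of `K` as characteristic map. The new cell is the
top element of the face poset. -/
noncomputable def CellStructure.addBall {n : ℕ} {M : Type}
    {L : Set (Metric.sphere (0 : EuclideanSpace ℝ (Fin n)) 1)} (τ : CellStructure L M) :
    CellStructure (ballUnion L) (WithTop M) where
  strat x := if h : ∃ y : L, ballUnionIncl L y = x then (τ.strat h.choose : WithTop M) else ⊤
  cell
    | ⊤ =>
      { dim := n
        domain := ballUnion L
        ball_subset := Set.subset_union_left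
        subset_closedBall := Set.union_subset Metric.ball_subset_closedBall
          (by rintro _ ⟨y, -, rfl⟩; exact Metric.sphere_subset_closedBall y.2)
        char := ContinuousMap.id _ }
    | (m : M) =>
      { dim := (τ.cell m).dim
        domain := (τ.cell m).domain
        ball_subset := (τ.cell m).ball_subset
        subset_closedBall := (τ.cell m).subset_closedBall
        char := (ballUnionIncl L).comp (τ.cell m).char }

/-- `H` is a deformation retraction of `X` onto `A`: a homotopy from the identity of `X` to a
retraction of `X` onto `A`. -/
structure IsDeformationRetraction {X : Type} [TopologicalSpace X] (A : Set X)
    (H : C(X × unitInterval, X)) : Prop where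
  map_zero : ∀ x, H (x, 0) = x
  map_one_mem : ∀ x, H (x, 1) ∈ A
  map_one : ∀ x ∈ A, H (x, 1) = x

/-- A deformation retraction is strong if it fixes `A` pointwise at all times. -/
structure IsStrongDeformationRetraction {X : Type} [TopologicalSpace X] (A : Set X)
    (H : C(X × unitInterval, X)) : Prop extends IsDeformationRetraction A H where
  fixed : ∀ x ∈ A, ∀ s, H (x, s) = x

/-! Both `K` and the image `B` of `Sd(K)` are absolute extensors, so the deformation is obtained by
extending a partial map rather than by following radial lines.

For `B`: compactness of the sphere leaves finitely many cells (`IsCW.finite`), and the cells of `L`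
inject into those of the sphere. Regularity makes lifts unique, so a point of `B` is determined by
its barycentric coordinates and determines them (`coord_eq_iff`). Compactness then makes `B`
homeomorphic to the order complex of the face poset. This poset has a largest element, the `n`-cell,
and its order complex is a retract of a Euclidean space (`orderComplexRetract`), so Tietze's theorem
applies to `B`.

For `K`: a map defined on a closed subset `C` of a metric space extends into the closed ball, and
shrinking it away from `C` keeps it in the open ball there (`exists_extension_ballUnion`).

Given a homotopy on a closed set `Q`, one extends its time-one map to a retraction `r : K → B`,
prescribes the identity at time `0`, `r` at time `1` and the homotopy over `Q`, and extends to `K ×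
[0,1]`. Taking `Q` to be `B`, `L` or `L ∪ B` gives the three claims, since `B ∩ L` is the image of
`Sd(L)`. -/

open Topology

/-! ### Radial scaling of cell domains. -/

namespace StratCell

variable {X : Type} [TopologicalSpace X]

lemma norm_le_one (c : StratCell X) (z : c.domain) : ‖(z : EuclideanSpace ℝ (Fin c.dim))‖ ≤ 1 := by
  simpa using c.subset_closedBall z.2

@[simp] lemma coe_scale (c : StratCell X) (r : unitInterval) (z : c.domain) :
    (c.scale r z : EuclideanSpace ℝ (Fin c.dim)) = (r : ℝ) • (z : EuclideanSpace ℝ (Fin c.dim)) :=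
  rfl

@[simp] lemma coe_origin (c : StratCell X) :
    (c.origin : EuclideanSpace ℝ (Fin c.dim)) = 0 := rfl

lemma continuous_scale (c : StratCell X) :
    Continuous fun q : unitInterval × c.domain => c.scale q.1 q.2 := by
  refine Continuous.subtype_mk ?_ _
  fun_prop

lemma scale_one (c : StratCell X) (z : c.domain) : c.scale 1 z = z :=
  Subtype.ext (one_smul ℝ _)

lemma scale_zero (c : StratCell X) (z : c.domain) : c.scale 0 z = c.origin :=
  Subtype.ext (zero_smul ℝ _)

lemma scale_origin (c : StratCell X) (r : unitInterval) : c.scale r c.origin = c.origin :=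
  Subtype.ext (smul_zero _)

lemma scale_scale (c : StratCell X) (r s : unitInterval) (z : c.domain) :
    c.scale r (c.scale s z) = c.scale (r * s) z :=
  Subtype.ext (smul_smul _ _ _)

end StratCell

/-! ### Iterated cone points and their barycentric coordinates. -/

namespace CellStructure

variable {X Λ : Type} [TopologicalSpace X]

/-- The consequences of the axioms of a regular cellular stratification that determine its
barycentric subdivision. -/
structure RegularFaces [PartialOrder Λ] (σ : CellStructure X Λ) : Prop where
  isEmbedding_char : ∀ l, IsEmbedding (σ.cell l).char
  image_interior : ∀ l, (σ.cell l).char '' (σ.cell l).interior = σ.stratum l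
  le_iff : ∀ l m, l ≤ m ↔ Set.range (σ.cell l).char ⊆ Set.range (σ.cell m).char
  disjoint : ∀ l m, l < m → Disjoint (Set.range (σ.cell l).char) (σ.stratum m)

/-- Only `disjoint` needs an argument: a cell whose stratum meets the closure of another stratum has
smaller dimension, so two distinct cells cannot meet each other's closures. -/
lemma IsCellularStratification.regularFaces [PartialOrder Λ] {σ : CellStructure X Λ}
    (h : σ.IsCellularStratification) (hr : σ.IsRegular) : σ.RegularFaces where
  isEmbedding_char := hr
  image_interior := h.image_interior
  le_iff l m := by
    rw [h.le_iff, h.range_char, h.range_char]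
    exact isClosed_closure.closure_subset_iff.symm
  disjoint l m hlm := by
    rw [h.range_char, Set.disjoint_left]
    intro x hx hxm
    have hne : ∀ {a b : Λ} {y : X}, a ≠ b → y ∈ σ.stratum a → y ∉ σ.stratum b :=
      fun hab ha hb => hab (ha.symm.trans hb)
    have key : ∀ {a b : Λ} {y : X}, a ≠ b → y ∈ σ.stratum a → y ∈ closure (σ.stratum b) →
        (σ.cell a).dim < (σ.cell b).dim := by
      intro a b y hab ha hb
      obtain ⟨F, hF, hs⟩ := h.boundary b
      obtain ⟨p, hp⟩ := Set.mem_iUnion.1 (hs ⟨hb, hne hab ha⟩)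
      obtain ⟨hpF, hp⟩ := Set.mem_iUnion.1 hp
      have hpa : p = a := hp.symm.trans ha
      exact hpa ▸ hF p hpF
    obtain ⟨y, hy⟩ := (h.connected l).nonempty
    exact lt_asymm (key hlm.ne' hxm hx) (key hlm.ne hy ((h.le_iff l m).1 hlm.le hy))

open Classical in
/-- The coordinates of a vertex of the barycentric subdivision. -/
noncomputable def vertexCoord (p : Λ) : Λ → ℝ := fun q => if q = p then 1 else 0

@[simp] lemma vertexCoord_self (p : Λ) : vertexCoord p p = 1 := if_pos rfl

lemma vertexCoord_of_ne {p q : Λ} (h : q ≠ p) : vertexCoord p q = 0 := if_neg h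

lemma vertexCoord_nonneg (p q : Λ) : 0 ≤ vertexCoord p q := by
  unfold vertexCoord; split_ifs <;> norm_num

lemma vertexCoord_le_one (p q : Λ) : vertexCoord p q ≤ 1 := by
  unfold vertexCoord; split_ifs <;> norm_num

lemma sum_vertexCoord [Fintype Λ] (p : Λ) : ∑ q, vertexCoord p q = 1 := by
  rw [Finset.sum_eq_single p (fun q _ hq => vertexCoord_of_ne hq) (by simp), vertexCoord_self]

/-- The points of the domains of the cells that are obtained by iterated coning from the centres,
with their barycentric coordinates. -/
inductive ConePoint [PartialOrder Λ] (σ : CellStructure X Λ) :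
    ∀ p : Λ, (Λ → ℝ) → (σ.cell p).domain → Prop
  | base (p : Λ) : ConePoint σ p (vertexCoord p) (σ.cell p).origin
  | step {l m : Λ} (h : l < m) (b : StratCell.Lift (σ.cell l) (σ.cell m)) (r : unitInterval)
      {c : Λ → ℝ} {z : (σ.cell l).domain} (hz : ConePoint σ l c z) :
      ConePoint σ m ((r : ℝ) • c + (1 - (r : ℝ)) • vertexCoord m)
        ((σ.cell m).scale r (b.map z))

/-- Cone points with all the coordinates in the chain positive. -/
inductive ProperConePoint [PartialOrder Λ] (σ : CellStructure X Λ) :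
    ∀ p : Λ, (Λ → ℝ) → (σ.cell p).domain → Prop
  | base (p : Λ) : ProperConePoint σ p (vertexCoord p) (σ.cell p).origin
  | step {l m : Λ} (h : l < m) (b : StratCell.Lift (σ.cell l) (σ.cell m)) (r : unitInterval)
      (h0 : 0 < (r : ℝ)) (h1 : (r : ℝ) < 1)
      {c : Λ → ℝ} {z : (σ.cell l).domain} (hz : ProperConePoint σ l c z) :
      ProperConePoint σ m ((r : ℝ) • c + (1 - (r : ℝ)) • vertexCoord m)
        ((σ.cell m).scale r (b.map z))

section ConePoint

variable [PartialOrder Λ] {σ : CellStructure X Λ}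

lemma ProperConePoint.conePoint {p : Λ} {c : Λ → ℝ} {z : (σ.cell p).domain}
    (h : σ.ProperConePoint p c z) : σ.ConePoint p c z := by
  induction h with
  | base p => exact .base p
  | step h b r h0 h1 hz ih => exact .step h b r ih

lemma ConePoint.nonneg {p : Λ} {c : Λ → ℝ} {z : (σ.cell p).domain}
    (h : σ.ConePoint p c z) (q : Λ) : 0 ≤ c q := by
  induction h with
  | base p => exact vertexCoord_nonneg _ _
  | step h b r hz ih =>
    exact add_nonneg (mul_nonneg r.2.1 ih)
      (mul_nonneg (sub_nonneg.2 r.2.2) (vertexCoord_nonneg _ _))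

lemma ConePoint.le_of_ne_zero {p : Λ} {c : Λ → ℝ} {z : (σ.cell p).domain}
    (h : σ.ConePoint p c z) {q : Λ} (hq : c q ≠ 0) : q ≤ p := by
  induction h with
  | base p =>
    by_contra hn
    exact hq (vertexCoord_of_ne fun e => hn e.le)
  | @step l m h b r c z hz ih =>
    by_cases hc : c q = 0
    · by_contra hn
      exact hq (by simp [hc, vertexCoord_of_ne (p := m) (q := q) fun e => hn e.le])
    · exact (ih hc).trans h.le

lemma ConePoint.sum_eq_one [Fintype Λ] {p : Λ} {c : Λ → ℝ} {z : (σ.cell p).domain}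
    (h : σ.ConePoint p c z) : ∑ q, c q = 1 := by
  induction h with
  | base p => exact sum_vertexCoord p
  | step h b r hz ih =>
    simp only [Pi.add_apply, Pi.smul_apply, smul_eq_mul, Finset.sum_add_distrib,
      ← Finset.mul_sum, ih, sum_vertexCoord]
    ring

lemma ConePoint.chain {p : Λ} {c : Λ → ℝ} {z : (σ.cell p).domain}
    (h : σ.ConePoint p c z) {q q' : Λ} (hq : c q ≠ 0) (hq' : c q' ≠ 0) : q ≤ q' ∨ q' ≤ q := by
  induction h with
  | base p =>
    have e : ∀ x, vertexCoord p x ≠ 0 → x = p := fun x hx => by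
      by_contra hn; exact hx (vertexCoord_of_ne hn)
    rw [e q hq, e q' hq']; exact Or.inl le_rfl
  | @step l m h b r c z hz ih =>
    have hs := ConePoint.step h b r hz
    by_cases e : q = m
    · exact Or.inr (e ▸ hs.le_of_ne_zero hq')
    by_cases e' : q' = m
    · exact Or.inl (e' ▸ hs.le_of_ne_zero hq)
    apply ih
    · intro hc; exact hq (by simp [hc, vertexCoord_of_ne e])
    · intro hc; exact hq' (by simp [hc, vertexCoord_of_ne e'])

lemma ConePoint.apply_eq_zero_of_lt {l m : Λ} (h : l < m) {c : Λ → ℝ} {z : (σ.cell l).domain}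
    (hz : σ.ConePoint l c z) : c m = 0 := by
  by_contra hc
  exact absurd (hz.le_of_ne_zero hc) h.not_ge

/-- Hence the image of a proper cone point lies in the stratum of its own cell, and the index `p`
can be recovered from the image. -/
lemma ProperConePoint.norm_lt {p : Λ} {c : Λ → ℝ} {z : (σ.cell p).domain}
    (h : σ.ProperConePoint p c z) : ‖(z : EuclideanSpace ℝ (Fin (σ.cell p).dim))‖ < 1 := by
  cases h with
  | base => simp
  | step h b r h0 h1 hz =>
    rw [StratCell.coe_scale, norm_smul, Real.norm_of_nonneg h0.le]
    exact (mul_le_of_le_one_right h0.le (StratCell.norm_le_one _ _)).trans_lt h1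

lemma ProperConePoint.apply_self_ne_zero {p : Λ} {c : Λ → ℝ} {z : (σ.cell p).domain}
    (h : σ.ProperConePoint p c z) : c p ≠ 0 := by
  cases h with
  | base => simp
  | step h b r h0 h1 hz =>
    simp [hz.conePoint.apply_eq_zero_of_lt h]
    linarith

end ConePoint

/-! ### Coordinates and points determine each other; compactness. -/

namespace RegularFaces

variable [PartialOrder Λ] {σ : CellStructure X Λ}

lemma strat_char (hσ : σ.RegularFaces) {p : Λ} {z : (σ.cell p).domain}
    (hz : ‖(z : EuclideanSpace ℝ (Fin (σ.cell p).dim))‖ < 1) :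
    σ.strat ((σ.cell p).char z) = p := by
  have : (σ.cell p).char z ∈ σ.stratum p := by
    rw [← hσ.image_interior]
    exact ⟨z, by simpa [StratCell.interior] using hz, rfl⟩
  exact this

/-- Characteristic maps are injective, so the face category is just the face poset. -/
lemma lift_ext (hσ : σ.RegularFaces) {l m : Λ} (a b : StratCell.Lift (σ.cell l) (σ.cell m)) :
    a = b := by
  ext1; ext1 x
  exact (hσ.isEmbedding_char m).injective ((a.comm x).trans (b.comm x).symm)

lemma exists_lift (hσ : σ.RegularFaces) {l m : Λ} (h : l ≤ m) :
    Nonempty (StratCell.Lift (σ.cell l) (σ.cell m)) := by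
  have hs := (hσ.le_iff l m).1 h
  choose g hg using fun x => hs ⟨x, rfl⟩
  exact ⟨⟨⟨g, (hσ.isEmbedding_char m).continuous_iff.2
    ((σ.cell l).char.continuous.congr fun x => (hg x).symm)⟩, hg⟩⟩

/-- The lift of the characteristic map of a cell along that of a larger cell. -/
noncomputable def lift (hσ : σ.RegularFaces) {l m : Λ} (h : l ≤ m) :
    StratCell.Lift (σ.cell l) (σ.cell m) :=
  (hσ.exists_lift h).some

lemma le_of_lift (hσ : σ.RegularFaces) {l m : Λ} (b : StratCell.Lift (σ.cell l) (σ.cell m)) :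
    l ≤ m := by
  rw [hσ.le_iff]
  rintro _ ⟨x, rfl⟩
  exact ⟨_, b.comm x⟩

/-- A value in the open ball would map into the stratum of `m`, which misses the closed cell of `l`.
Consequently the scaling factor of a cone point is its norm. -/
lemma norm_lift (hσ : σ.RegularFaces) {l m : Λ} (h : l < m)
    (b : StratCell.Lift (σ.cell l) (σ.cell m)) (z : (σ.cell l).domain) :
    ‖(b.map z : EuclideanSpace ℝ (Fin (σ.cell m).dim))‖ = 1 := by
  refine le_antisymm (StratCell.norm_le_one _ _) ?_
  by_contra hn
  have := hσ.strat_char (not_le.1 hn)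
  rw [b.comm] at this
  exact Set.disjoint_left.1 (hσ.disjoint l m h) ⟨z, rfl⟩ this

/-- The face poset, as a category, maps to the face category. -/
noncomputable def faceFunctor (hσ : σ.RegularFaces) : Λ ⥤ σ.FaceCategory where
  obj l := ⟨l⟩
  map h := hσ.lift (leOfHom h)
  map_id _ := hσ.lift_ext _ _
  map_comp _ _ := hσ.lift_ext _ _

/-- Degenerate steps can be removed: `r = 0` collapses everything to the centre of the new cell, and
`r = 1` leaves the point in the smaller cell. -/
lemma exists_proper (hσ : σ.RegularFaces) {m : Λ} {c : Λ → ℝ} {z : (σ.cell m).domain}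
    (h : σ.ConePoint m c z) : ∃ p ≤ m, ∃ z' : (σ.cell p).domain,
      σ.ProperConePoint p c z' ∧ (σ.cell p).char z' = (σ.cell m).char z := by
  induction h with
  | base p => exact ⟨p, le_rfl, _, .base p, rfl⟩
  | @step l m h b r c z hz ih =>
    obtain ⟨p, hp, z', hz', e⟩ := ih
    rcases r.2.1.eq_or_lt with h0 | h0
    · obtain rfl : r = 0 := Subtype.ext h0.symm
      refine ⟨m, le_rfl, _, ?_, rfl⟩
      rw [StratCell.scale_zero]
      simpa using ProperConePoint.base (σ := σ) m
    rcases r.2.2.eq_or_lt with h1 | h1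
    · obtain rfl : r = 1 := Subtype.ext h1
      refine ⟨p, hp.trans h.le, z', by simpa using hz', ?_⟩
      rw [StratCell.scale_one, b.comm, e]
    · refine ⟨m, le_rfl, _, .step (hp.trans_lt h) (hσ.lift (hp.trans h.le)) r h0 h1 hz', ?_⟩
      congr 2
      apply (hσ.isEmbedding_char m).injective
      rw [StratCell.Lift.comm, StratCell.Lift.comm, e]

/-- Peel off one cone at a time: the stratum identifies the apex, the norm identifies `r` by
`norm_lift`, and division by `r` leaves equal points on the boundary, to which induction applies. -/
lemma coord_eq_of_proper (hσ : σ.RegularFaces) {p p' : Λ} {c c' : Λ → ℝ}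
    {z : (σ.cell p).domain} {z' : (σ.cell p').domain} (h : σ.ProperConePoint p c z)
    (h' : σ.ProperConePoint p' c' z') (e : (σ.cell p).char z = (σ.cell p').char z') : c = c' := by
  induction h generalizing p' c' z' with
  | base p =>
    obtain rfl : p = p' := by
      rw [← hσ.strat_char h'.norm_lt, ← e]
      exact (hσ.strat_char (by simp)).symm
    have ez := congrArg Subtype.val ((hσ.isEmbedding_char p).injective e)
    cases h' with
    | base => rfl
    | step hl b r h0 h1 hz =>
      have := congrArg norm ez
      rw [StratCell.coe_scale, norm_smul, hσ.norm_lift hl, Real.norm_of_nonneg h0.le] at this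
      simp at this
      linarith
  | @step l m hl b r h0 h1 c z hz ih =>
    have hlt := (ProperConePoint.step hl b r h0 h1 hz).norm_lt
    obtain rfl : m = p' := by
      rw [← hσ.strat_char h'.norm_lt, ← e, hσ.strat_char hlt]
    have ez := congrArg Subtype.val ((hσ.isEmbedding_char m).injective e)
    have en := congrArg norm ez
    rw [StratCell.coe_scale, norm_smul, hσ.norm_lift hl, Real.norm_of_nonneg h0.le] at en
    cases h' with
    | base =>
      simp at en
      simp [en] at h0
    | @step l' _ hl' b' r' h0' h1' c' z' hz' =>
      rw [StratCell.coe_scale, norm_smul, hσ.norm_lift hl', Real.norm_of_nonneg h0'.le,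
        mul_one, mul_one] at en
      rw [StratCell.coe_scale, StratCell.coe_scale, ← en] at ez
      have e1 : b.map z = b'.map z' := Subtype.ext (smul_right_injective _ h0.ne' ez)
      rw [ih hz' (by rw [← b.comm, ← b'.comm, e1]), en]

/-- The same peeling, read from the coordinates: the apex is the largest element of the support, its
coordinate is `1 - r`, and the rest is `r` times the coordinates of the previous point. -/
lemma char_eq_of_proper (hσ : σ.RegularFaces) {p p' : Λ} {c c' : Λ → ℝ}
    {z : (σ.cell p).domain} {z' : (σ.cell p').domain} (h : σ.ProperConePoint p c z)
    (h' : σ.ProperConePoint p' c' z') (e : c = c') :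
    (σ.cell p).char z = (σ.cell p').char z' := by
  obtain rfl : p = p' := by
    apply le_antisymm
    · exact h'.conePoint.le_of_ne_zero (e ▸ h.apply_self_ne_zero)
    · exact h.conePoint.le_of_ne_zero (e ▸ h'.apply_self_ne_zero)
  induction h generalizing c' with
  | base p =>
    cases h' with
    | base => rfl
    | step hl b r h0 h1 hz =>
      have := congrFun e p
      simp [hz.conePoint.apply_eq_zero_of_lt hl] at this
      linarith
  | @step l m hl b r h0 h1 c z hz ih =>
    have em := congrFun e m
    simp [hz.conePoint.apply_eq_zero_of_lt hl] at em
    cases h' with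
    | base =>
      simp at em
      simp [em] at h0
    | @step l' _ hl' b' r' h0' h1' c' z' hz' =>
      simp [hz'.conePoint.apply_eq_zero_of_lt hl'] at em
      obtain rfl : r = r' := Subtype.ext em
      have ec : c = c' := smul_right_injective _ h0.ne' (add_right_cancel e)
      obtain rfl : l = l' := by
        apply le_antisymm
        · exact hz'.conePoint.le_of_ne_zero (ec ▸ hz.apply_self_ne_zero)
        · exact hz.conePoint.le_of_ne_zero (ec ▸ hz'.apply_self_ne_zero)
      have := ih ec hz'
      congr 2
      apply (hσ.isEmbedding_char m).injective
      rw [b.comm, b'.comm, this]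

lemma coord_eq_iff (hσ : σ.RegularFaces) {p p' : Λ} {c c' : Λ → ℝ}
    {z : (σ.cell p).domain} {z' : (σ.cell p').domain} (h : σ.ConePoint p c z)
    (h' : σ.ConePoint p' c' z') : c = c' ↔ (σ.cell p).char z = (σ.cell p').char z' := by
  obtain ⟨q, -, w, hw, e⟩ := hσ.exists_proper h
  obtain ⟨q', -, w', hw', e'⟩ := hσ.exists_proper h'
  rw [← e, ← e']
  exact ⟨hσ.char_eq_of_proper hw hw', hσ.coord_eq_of_proper hw hw'⟩

/-- Chains in the face category may repeat a cell. A repetition is an identity lift, and two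
successive scalings by `r` and `r'` merge into one by `r * r'`. -/
lemma conePoint_step_le (hσ : σ.RegularFaces) {l m : Λ}
    (b : StratCell.Lift (σ.cell l) (σ.cell m)) (r : unitInterval)
    {c : Λ → ℝ} {z : (σ.cell l).domain} (hz : σ.ConePoint l c z) :
    σ.ConePoint m ((r : ℝ) • c + (1 - (r : ℝ)) • vertexCoord m)
      ((σ.cell m).scale r (b.map z)) := by
  rcases (hσ.le_of_lift b).eq_or_lt with rfl | h
  · have hb : b.map z = z := (hσ.isEmbedding_char l).injective (b.comm z)
    rw [hb]
    cases hz with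
    | base =>
      rw [StratCell.scale_origin, ← add_smul]
      simpa using ConePoint.base (σ := σ) l
    | @step l' _ h' b' r' c' z' hz' =>
      rw [StratCell.scale_scale]
      convert ConePoint.step h' b' (r * r') hz' using 1
      ext q
      simp
      ring
  · exact .step h b r hz

/-- Induction over the poset: the cone points of `m` are the centre together with finitely many
continuous images of `[0,1]` times the compact sets for `l < m`. The domains themselves need not be
compact. -/
lemma isCompact_conePoint (hσ : σ.RegularFaces) [Finite Λ] (m : Λ) :
    IsCompact {q : (Λ → ℝ) × (σ.cell m).domain | σ.ConePoint m q.1 q.2} := by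
  induction m using WellFoundedLT.induction with
  | ind m ih =>
    have hU : IsCompact (⋃ l : {l // l < m},
        (fun q : unitInterval × (Λ → ℝ) × (σ.cell l.1).domain =>
          ((q.1 : ℝ) • q.2.1 + (1 - (q.1 : ℝ)) • vertexCoord m,
            (σ.cell m).scale q.1 ((hσ.lift l.2.le).map q.2.2))) ''
          (Set.univ ×ˢ {q | σ.ConePoint l.1 q.1 q.2})) := by
      refine isCompact_iUnion fun l => (isCompact_univ.prod (ih l.1 l.2)).image ?_
      refine Continuous.prodMk (by fun_prop) ?_
      exact (σ.cell m).continuous_scale.comp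
        (continuous_fst.prodMk ((map_continuous (hσ.lift l.2.le).map).comp (by fun_prop)))
    convert (isCompact_singleton (x := (vertexCoord m, (σ.cell m).origin))).union hU using 1
    ext ⟨c, z⟩
    constructor
    · intro h
      cases h with
      | base => exact Or.inl rfl
      | @step l _ h b r c z hz =>
        refine Or.inr (Set.mem_iUnion.2 ⟨⟨l, h⟩, ⟨r, c, z⟩, ⟨trivial, hz⟩, ?_⟩)
        rw [hσ.lift_ext b (hσ.lift h.le)]
        rfl
    · rintro (h | h)
      · obtain ⟨rfl, rfl⟩ := Prod.mk.inj h
        exact .base m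
      · obtain ⟨l, ⟨r, c', z'⟩, ⟨-, hz⟩, e⟩ := Set.mem_iUnion.1 h
        obtain ⟨rfl, rfl⟩ := Prod.mk.inj e
        exact ConePoint.step l.2 _ r hz

/-- The truncated chain carries coordinates rescaled to sum `1`, which is why the partial sum must
be positive. -/
lemma conePoint_chainPoint (hσ : σ.RegularFaces) {k : ℕ}
    (F : ComposableArrows σ.FaceCategory k) (t : stdSimplex ℝ (Fin (k + 1))) (j : Fin (k + 1))
    (hj : 0 < partialSum t j) :
    σ.ConePoint (F.obj j).idx
      ((partialSum t j)⁻¹ • ∑ i ∈ Finset.Iic j, t i • vertexCoord (F.obj i).idx)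
      (σ.chainPoint F t j) := by
  induction j using Fin.induction with
  | zero =>
    have h0 : Finset.Iic (0 : Fin (k + 1)) = {0} := by
      ext i; simp
    rw [partialSum, h0, Finset.sum_singleton] at hj
    rw [chainPoint_zero, partialSum, h0, Finset.sum_singleton, Finset.sum_singleton,
      inv_smul_smul₀ hj.ne']
    exact .base _
  | succ j ih =>
    have hI : Finset.Iic j.succ = insert j.succ (Finset.Iic j.castSucc) := by
      ext i
      simp only [Finset.mem_Iic, Finset.mem_insert, Fin.le_def, Fin.ext_iff, Fin.val_succ,
        Fin.val_castSucc]
      omega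
    have hn : j.succ ∉ Finset.Iic j.castSucc := by simp
    have hS : partialSum t j.succ = t j.succ + partialSum t j.castSucc := by
      rw [partialSum, hI, Finset.sum_insert hn, partialSum]
    rw [hI, Finset.sum_insert hn, chainPoint_succ]
    rcases (partialSum_nonneg t j.castSucc).eq_or_lt with h0 | h0
    -- All earlier weights vanish, so the induction hypothesis is unavailable; but the ratio is `0`
    -- and the previous point is sent to the centre whatever it is.
    · have hr : ratio t j = 0 := Subtype.ext (by simp [ratio, ← h0])
      have ht : ∀ i ∈ Finset.Iic j.castSucc, t i = 0 :=
        (Finset.sum_eq_zero_iff_of_nonneg fun i _ => stdSimplex.zero_le t i).1 h0.symm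
      rw [hr, StratCell.scale_zero, Finset.sum_eq_zero fun i hi => by rw [ht i hi, zero_smul],
        hS, ← h0, add_zero, add_zero, inv_smul_smul₀]
      · exact .base _
      · rw [hS, ← h0, add_zero] at hj
        exact hj.ne'
    · convert hσ.conePoint_step_le (F.map (homOfLE j.castSucc_lt_succ.le)) (ratio t j) (ih h0)
        using 1
      have h1 : 1 - ((ratio t j : unitInterval) : ℝ) = (partialSum t j.succ)⁻¹ * t j.succ := by
        simp only [ratio]
        rw [hS] at hj ⊢
        field_simp
        ring
      rw [h1, smul_smul, smul_add, smul_smul, add_comm]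
      congr 2
      simp only [ratio]
      field_simp

lemma conePoint_simplexMap (hσ : σ.RegularFaces) {k : ℕ}
    (F : ComposableArrows σ.FaceCategory k) (t : stdSimplex ℝ (Fin (k + 1))) :
    σ.ConePoint (F.obj (Fin.last k)).idx (∑ i, t i • vertexCoord (F.obj i).idx)
      (σ.chainPoint F t (Fin.last k)) := by
  have h := hσ.conePoint_chainPoint F t (Fin.last k) (by rw [partialSum_last]; exact one_pos)
  have hu : Finset.Iic (Fin.last k) = Finset.univ := by
    ext i; simp [Fin.le_last]
  rwa [partialSum_last, inv_one, one_smul, hu] at h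

end RegularFaces

/-- The geometric realization of the order complex of a finite poset. -/
def orderComplex (Λ : Type) [PartialOrder Λ] [Fintype Λ] : Set (Λ → ℝ) :=
  {c | (∀ p, 0 ≤ c p) ∧ ∑ p, c p = 1 ∧ ∀ p q, c p ≠ 0 → c q ≠ 0 → p ≤ q ∨ q ≤ p}

/-- The support is a nonempty finite chain; list it in increasing order. -/
lemma exists_chain_of_mem_orderComplex [PartialOrder Λ] [Fintype Λ] {c : Λ → ℝ}
    (hc : c ∈ orderComplex Λ) : ∃ (k : ℕ) (g : Fin (k + 1) →o Λ) (t : stdSimplex ℝ (Fin (k + 1))),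
      ∑ i, t i • vertexCoord (g i) = c := by
  classical
  obtain ⟨hc0, hc1, hc2⟩ := hc
  let S := {p : Λ // c p ≠ 0}
  let _ : LinearOrder S :=
    { (inferInstance : PartialOrder S) with
      le_total := fun p q => hc2 p q p.2 q.2
      toDecidableLE := Classical.decRel _ }
  have hsub : ∀ f : Λ → ℝ, (∀ p, c p = 0 → f p = 0) → ∑ p : S, f p = ∑ p, f p := by
    intro f hf
    rw [← Finset.sum_subtype (Finset.univ.filter fun p => c p ≠ 0) (by simp)]
    exact Finset.sum_subset (Finset.subset_univ _)
      fun p _ hp => hf p (by simpa using hp)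
  have hne : Fintype.card S ≠ 0 := by
    intro hn
    have := Fintype.card_eq_zero_iff.1 hn
    have h := hsub c fun _ h => h
    rw [hc1] at h
    simp at h
  obtain ⟨k, hk⟩ := Nat.exists_eq_succ_of_ne_zero hne
  let e : Fin (k + 1) ≃o S := Fintype.orderIsoFinOfCardEq S hk
  have hsum : ∀ f : Λ → ℝ, (∀ p, c p = 0 → f p = 0) → ∑ i, f (e i) = ∑ p, f p := fun f hf =>
    (Equiv.sum_comp e.toEquiv fun p : S => f p).trans (hsub f hf)
  refine ⟨k, ⟨fun i => e i, fun i j h => e.monotone h⟩,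
    ⟨fun i => c (e i), fun i => hc0 _, ?_⟩, ?_⟩
  · rw [hsum c fun _ h => h, hc1]
  · ext p
    rw [Finset.sum_apply]
    refine (hsum (fun q => c q * vertexCoord q p) fun q hq => by simp [hq]).trans ?_
    rw [Finset.sum_eq_single p]
    · simp
    · intro q _ hq; simp [vertexCoord_of_ne hq.symm]
    · simp

namespace RegularFaces

variable [PartialOrder Λ] {σ : CellStructure X Λ}

lemma range_sdMap_eq (hσ : σ.RegularFaces) [Finite Λ] :
    Set.range σ.sdMap = {x | ∃ p c z, σ.ConePoint p c z ∧ (σ.cell p).char z = x} := by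
  have := Fintype.ofFinite Λ
  rw [range_sdMap]
  ext x
  constructor
  · rintro ⟨k, F, t, rfl⟩
    exact ⟨_, _, _, hσ.conePoint_simplexMap F t, rfl⟩
  · rintro ⟨p, c, z, h, rfl⟩
    obtain ⟨k, g, t, e⟩ := exists_chain_of_mem_orderComplex (c := c)
      ⟨h.nonneg, h.sum_eq_one, fun _ _ => h.chain⟩
    let F : ComposableArrows σ.FaceCategory k := g.monotone.functor ⋙ hσ.faceFunctor
    exact ⟨k, F, t, (hσ.coord_eq_iff (hσ.conePoint_simplexMap F t) h).1 e⟩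

/-- The points of the barycentric subdivision together with their coordinates. -/
def coordGraph (σ : CellStructure X Λ) : Set ((Λ → ℝ) × X) :=
  {q | ∃ p z, σ.ConePoint p q.1 z ∧ (σ.cell p).char z = q.2}

lemma isCompact_coordGraph (hσ : σ.RegularFaces) [Finite Λ] : IsCompact (coordGraph σ) := by
  convert isCompact_iUnion fun p => (hσ.isCompact_conePoint p).image
    (f := fun q => (q.1, (σ.cell p).char q.2)) (by fun_prop) using 1
  ext ⟨c, x⟩
  simp only [coordGraph, Set.mem_ofPred_eq, Set.mem_iUnion, Set.mem_image, Prod.exists,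
    Prod.mk.injEq]
  constructor
  · rintro ⟨p, z, h, rfl⟩
    exact ⟨p, c, z, h, rfl, rfl⟩
  · rintro ⟨p, c, z, h, rfl, rfl⟩
    exact ⟨p, z, h, rfl⟩

lemma isCompact_range_sdMap (hσ : σ.RegularFaces) [Finite Λ] : IsCompact (Set.range σ.sdMap) := by
  convert hσ.isCompact_coordGraph.image continuous_snd using 1
  rw [hσ.range_sdMap_eq]
  ext x
  simp [coordGraph]
  tauto

end RegularFaces

end CellStructure

/-! ### The order complex of a finite poset with top is an absolute extensor. -/

namespace CellStructure

section OrderComplex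

variable {Λ : Type} [PartialOrder Λ] [Fintype Λ]

open Classical in
/-- The excess of a coordinate over those of the incomparable elements. -/
noncomputable def excess (t : Λ → ℝ) (p : Λ) : ℝ :=
  max 0 (max 0 (t p) - ∑ q with ¬(p ≤ q ∨ q ≤ p), max 0 (t q))

lemma continuous_excess (p : Λ) : Continuous fun t : Λ → ℝ => excess t p := by
  unfold excess
  fun_prop

lemma excess_nonneg (t : Λ → ℝ) (p : Λ) : 0 ≤ excess t p := le_max_left _ _

/-- For incomparable elements, a nonzero excess at one forces its positive part to exceed strictly
that of the other; this cannot hold both ways. -/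
lemma comparable_of_excess_ne_zero {t : Λ → ℝ} {p q : Λ} (hp : excess t p ≠ 0)
    (hq : excess t q ≠ 0) : p ≤ q ∨ q ≤ p := by
  classical
  have key : ∀ {a b : Λ}, ¬(a ≤ b ∨ b ≤ a) → excess t a ≠ 0 → max 0 (t b) < max 0 (t a) := by
    intro a b hab ha
    by_contra hn
    apply ha
    refine max_eq_left (sub_nonpos.2 ((not_lt.1 hn).trans ?_))
    exact Finset.single_le_sum (f := fun q => max 0 (t q)) (fun _ _ => le_max_left _ _)
      (by simpa using hab)
  by_contra hn
  exact lt_asymm (key hn hp) (key (fun h => hn h.symm) hq)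

lemma excess_eq_self {t : Λ → ℝ} (ht : t ∈ orderComplex Λ) (p : Λ) : excess t p = t p := by
  classical
  obtain ⟨h0, -, h2⟩ := ht
  unfold excess
  rw [max_eq_right (h0 p)]
  by_cases hp : t p = 0
  · rw [hp, zero_sub]
    exact max_eq_left (neg_nonpos.2 (Finset.sum_nonneg fun _ _ => le_max_left _ _))
  · rw [Finset.sum_eq_zero, sub_zero, max_eq_right (h0 p)]
    intro q hq
    have hq' : t q = 0 := by
      by_contra hn
      exact (Finset.mem_filter.1 hq).2 (h2 p q hp hn)
    simp [hq']

variable [OrderTop Λ]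

/-- The excess at the elements other than the largest one. -/
noncomputable def lowerExcess (t : Λ → ℝ) (p : Λ) : ℝ := excess t p * (1 - vertexCoord ⊤ p)

lemma lowerExcess_nonneg (t : Λ → ℝ) (p : Λ) : 0 ≤ lowerExcess t p :=
  mul_nonneg (excess_nonneg t p) (sub_nonneg.2 (vertexCoord_le_one _ _))

/-- A retraction of `Λ → ℝ` onto the order complex of a poset with a largest element. -/
noncomputable def orderComplexRetract (t : Λ → ℝ) (p : Λ) : ℝ :=
  lowerExcess t p / max 1 (∑ q, lowerExcess t q) +
    (1 - (∑ q, lowerExcess t q) / max 1 (∑ q, lowerExcess t q)) * vertexCoord ⊤ p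

lemma continuous_orderComplexRetract :
    Continuous (orderComplexRetract : (Λ → ℝ) → Λ → ℝ) := by
  have h : ∀ p : Λ, Continuous fun t : Λ → ℝ => lowerExcess t p := fun p =>
    (continuous_excess p).mul continuous_const
  have hm : ∀ t : Λ → ℝ, max 1 (∑ q, lowerExcess t q) ≠ 0 := fun t =>
    (zero_lt_one.trans_le (le_max_left _ _)).ne'
  unfold orderComplexRetract
  fun_prop (disch := exact hm _)

/-- The total excess may be zero, so one cannot normalize by it. Dividing by `max 1` of the sum and
giving the missing mass to `⊤` avoids this, and `⊤` is comparable to everything, so the support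
remains a chain. -/
lemma orderComplexRetract_mem (t : Λ → ℝ) : orderComplexRetract t ∈ orderComplex Λ := by
  have hm : 0 < max 1 (∑ q, lowerExcess t q) := zero_lt_one.trans_le (le_max_left _ _)
  refine ⟨fun p => ?_, ?_, fun p q hp hq => ?_⟩
  · refine add_nonneg (div_nonneg (lowerExcess_nonneg t p) hm.le)
      (mul_nonneg (sub_nonneg.2 ?_) (vertexCoord_nonneg _ _))
    exact (div_le_one hm).2 (le_max_right _ _)
  · simp only [orderComplexRetract, Finset.sum_add_distrib, ← Finset.mul_sum, ← Finset.sum_div,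
      sum_vertexCoord]
    ring
  · by_cases ep : p = ⊤
    · exact Or.inr (ep ▸ le_top)
    by_cases eq : q = ⊤
    · exact Or.inl (eq ▸ le_top)
    apply comparable_of_excess_ne_zero (t := t)
    · intro h; exact hp (by simp [orderComplexRetract, lowerExcess, h, vertexCoord_of_ne ep])
    · intro h; exact hq (by simp [orderComplexRetract, lowerExcess, h, vertexCoord_of_ne eq])

lemma orderComplexRetract_of_mem {t : Λ → ℝ} (ht : t ∈ orderComplex Λ) :
    orderComplexRetract t = t := by
  have hv : ∀ p : Λ, t p * vertexCoord ⊤ p = t ⊤ * vertexCoord ⊤ p := fun p => by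
    by_cases h : p = ⊤
    · rw [h]
    · simp [vertexCoord_of_ne h]
  have hl : ∀ p, lowerExcess t p = t p - t ⊤ * vertexCoord ⊤ p := fun p => by
    rw [lowerExcess, excess_eq_self ht, ← hv]
    ring
  have hs : ∑ q, lowerExcess t q = 1 - t ⊤ := by
    simp only [hl, Finset.sum_sub_distrib, ← Finset.mul_sum, sum_vertexCoord, ht.2.1, mul_one]
  ext p
  rw [orderComplexRetract, hs, max_eq_left (by linarith [ht.1 ⊤]), hl]
  ring

end OrderComplex

instance orderComplex.instTietzeExtension {Λ : Type} [PartialOrder Λ] [Fintype Λ] [OrderTop Λ] :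
    TietzeExtension.{0, 0} (orderComplex Λ) :=
  .of_retract ⟨Subtype.val, continuous_subtype_val⟩
    ⟨fun t => ⟨orderComplexRetract t, orderComplexRetract_mem t⟩,
      continuous_orderComplexRetract.subtype_mk _⟩
    (by ext1 t; exact Subtype.ext (orderComplexRetract_of_mem t.2))

namespace RegularFaces

variable {X Λ : Type} [TopologicalSpace X] [PartialOrder Λ] {σ : CellStructure X Λ}

lemma coord_mem_orderComplex [Fintype Λ] {q : (Λ → ℝ) × X} (hq : q ∈ coordGraph σ) :
    q.1 ∈ orderComplex Λ := by
  obtain ⟨p, z, h, -⟩ := hq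
  exact ⟨h.nonneg, h.sum_eq_one, fun _ _ => h.chain⟩

/-- The homeomorphism from the graph of the barycentric coordinates to the order complex. -/
noncomputable def graphHomeoOrderComplex (hσ : σ.RegularFaces) [Fintype Λ] [T2Space X] :
    coordGraph σ ≃ₜ orderComplex Λ :=
  have : CompactSpace (coordGraph σ) := isCompact_iff_compactSpace.1 hσ.isCompact_coordGraph
  have hbij : Function.Bijective fun q : coordGraph σ =>
      (⟨q.1.1, coord_mem_orderComplex q.2⟩ : orderComplex Λ) := by
    constructor
    · rintro ⟨⟨c, x⟩, hq⟩ ⟨⟨c', x'⟩, hq'⟩ e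
      have e' : c = c' := congrArg Subtype.val e
      obtain ⟨p, z, h, hx⟩ := id hq
      obtain ⟨p', z', h', hx'⟩ := id hq'
      exact Subtype.ext (Prod.ext e' (hx.symm.trans (((hσ.coord_eq_iff h h').1 e').trans hx')))
    · rintro ⟨c, hc⟩
      obtain ⟨k, g, t, e⟩ := exists_chain_of_mem_orderComplex hc
      have h := hσ.conePoint_simplexMap (g.monotone.functor ⋙ hσ.faceFunctor) t
      exact ⟨⟨(c, _), _, _, e ▸ h, rfl⟩, rfl⟩
  Continuous.homeoOfEquivCompactToT2 (f := Equiv.ofBijective _ hbij)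
    ((continuous_fst.comp continuous_subtype_val).subtype_mk _)

/-- The homeomorphism from the graph of the barycentric coordinates to the image of the
barycentric subdivision. -/
noncomputable def graphHomeoRange (hσ : σ.RegularFaces) [Finite Λ] [T2Space X] :
    coordGraph σ ≃ₜ Set.range σ.sdMap :=
  have : CompactSpace (coordGraph σ) := isCompact_iff_compactSpace.1 hσ.isCompact_coordGraph
  have hmem : ∀ q ∈ coordGraph σ, q.2 ∈ Set.range σ.sdMap := by
    rintro q ⟨p, z, h, e⟩
    rw [hσ.range_sdMap_eq]
    exact ⟨p, _, z, h, e⟩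
  have hbij : Function.Bijective fun q : coordGraph σ =>
      (⟨q.1.2, hmem q.1 q.2⟩ : Set.range σ.sdMap) := by
    constructor
    · rintro ⟨⟨c, x⟩, hq⟩ ⟨⟨c', x'⟩, hq'⟩ e
      have e' : x = x' := congrArg Subtype.val e
      obtain ⟨p, z, h, hx⟩ := id hq
      obtain ⟨p', z', h', hx'⟩ := id hq'
      exact Subtype.ext (Prod.ext ((hσ.coord_eq_iff h h').2 (hx.trans (e'.trans hx'.symm))) e')
    · rintro ⟨x, hx⟩
      have hx' := hx
      rw [hσ.range_sdMap_eq] at hx'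
      obtain ⟨p, c, z, h, e⟩ := hx'
      exact ⟨⟨(c, x), p, z, h, e⟩, rfl⟩
  Continuous.homeoOfEquivCompactToT2 (f := Equiv.ofBijective _ hbij)
    ((continuous_snd.comp continuous_subtype_val).subtype_mk _)

/-- The compact graph of the coordinates projects bijectively to both the image of the subdivision
and the order complex, so it links them by homeomorphisms. -/
lemma tietzeExtension_range_sdMap (hσ : σ.RegularFaces) [Finite Λ] [OrderTop Λ] [T2Space X] :
    TietzeExtension.{0, 0} (Set.range σ.sdMap) :=
  have := Fintype.ofFinite Λ
  .of_homeo (hσ.graphHomeoRange.symm.trans hσ.graphHomeoOrderComplex)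

end RegularFaces

end CellStructure

/-! ### Extension of partial maps and homotopies. -/

section Extension

lemma ContinuousOn.exists_extension_of_mapsTo {X Z : Type} [TopologicalSpace X]
    [TopologicalSpace Z] [NormalSpace Z] {B : Set X} [TietzeExtension.{0, 0} B] {C : Set Z}
    (hC : IsClosed C) {f : Z → X} (hf : ContinuousOn f C) (hB : Set.MapsTo f C B) :
    ∃ g : C(Z, X), (∀ z, g z ∈ B) ∧ Set.EqOn g f C := by
  obtain ⟨g, hg⟩ := ContinuousMap.exists_restrict_eq hC
    (⟨fun z => ⟨f z, hB z.2⟩, hf.domRestrict.subtype_mk _⟩ : C(C, B))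
  refine ⟨⟨fun z => g z, by fun_prop⟩, fun z => (g z).2, fun z hz => ?_⟩
  exact congrArg Subtype.val (DFunLike.congr_fun hg ⟨z, hz⟩)

variable {n : ℕ} {L : Set (Metric.sphere (0 : EuclideanSpace ℝ (Fin n)) 1)}

lemma ballUnion_subset_closedBall : ballUnion L ⊆ Metric.closedBall 0 1 :=
  Set.union_subset Metric.ball_subset_closedBall
    (by rintro _ ⟨y, -, rfl⟩; exact Metric.sphere_subset_closedBall y.2)

/-- `Int D^n ∪ L` is an absolute extensor for metrizable spaces. -/
lemma exists_extension_ballUnion {Z : Type} [PseudoMetricSpace Z] {C : Set Z} (hC : IsClosed C)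
    {f : Z → ballUnion L} (hf : ContinuousOn f C) :
    ∃ g : C(Z, ballUnion L), Set.EqOn g f C := by
  rcases C.eq_empty_or_nonempty with rfl | hne
  -- The empty set is treated apart because `Metric.infDist` to it is `0` by convention, and the
  -- shrinking below would do nothing.
  · exact ⟨.const _ ⟨0, Or.inl (by simp)⟩, fun _ h => h.elim⟩
  obtain ⟨g, hg1, hg2⟩ := ContinuousOn.exists_extension_of_mapsTo
    (B := Metric.closedBall (0 : EuclideanSpace ℝ (Fin n)) 1) hC
    (f := fun z => (f z : EuclideanSpace ℝ (Fin n)))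
    (continuous_subtype_val.comp_continuousOn hf)
    (fun z _ => ballUnion_subset_closedBall (f z).2)
  have hd : ∀ z, 0 < 1 + Metric.infDist z C := fun z =>
    add_pos_of_pos_of_nonneg one_pos Metric.infDist_nonneg
  -- The factor is `1` on `C` and, as `C` is closed, less than `1` elsewhere: values off `C` are
  -- pushed into the open ball, so only boundary points already in `L` occur.
  have h0 : ∀ z ∈ C, (1 + Metric.infDist z C)⁻¹ • g z = f z := fun z hz => by
    rw [Metric.infDist_zero_of_mem hz, add_zero, inv_one, one_smul, hg2 hz]
  refine ⟨⟨fun z => ⟨(1 + Metric.infDist z C)⁻¹ • g z, ?_⟩, ?_⟩, fun z hz => Subtype.ext (h0 z hz)⟩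
  · by_cases hz : z ∈ C
    · rw [h0 z hz]
      exact (f z).2
    · left
      have hlt : 1 < 1 + Metric.infDist z C :=
        lt_add_of_pos_right _ ((hC.notMem_iff_infDist_pos hne).1 hz)
      rw [mem_ball_zero_iff, norm_smul, Real.norm_of_nonneg (inv_nonneg.2 (hd z).le)]
      exact (mul_le_of_le_one_right (inv_nonneg.2 (hd z).le) (by simpa using hg1 z)).trans_lt
        (inv_lt_one_of_one_lt₀ hlt)
  · refine Continuous.subtype_mk (Continuous.smul (Continuous.inv₀ ?_ fun z => (hd z).ne') ?_) _
    · exact continuous_const.add (Metric.continuous_infDist_pt C)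
    · exact map_continuous g

/-- A partial deformation on a closed subset extends to a deformation retraction of
`Int D^n ∪ L` onto a compact absolute extensor. -/
lemma exists_isDeformationRetraction_extension {B Q : Set (ballUnion L)}
    [TietzeExtension.{0, 0} B] (hB : IsClosed B) (hQ : IsClosed Q)
    (h : ballUnion L × unitInterval → ballUnion L) (hc : ContinuousOn h (Q ×ˢ Set.univ))
    (h0 : ∀ x ∈ Q, h (x, 0) = x) (h1 : ∀ x ∈ Q, h (x, 1) ∈ B)
    (hf : ∀ x ∈ Q, x ∈ B → h (x, 1) = x) :
    ∃ H : C(ballUnion L × unitInterval, ballUnion L),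
      IsDeformationRetraction B H ∧ ∀ x ∈ Q, ∀ s, H (x, s) = h (x, s) := by
  classical
  -- The future time-one map: it must be the identity on `B` and the end of the homotopy on `Q`, and
  -- these agree on `B ∩ Q` by `hf`.
  obtain ⟨r, hr1, hr2⟩ : ∃ r : C(ballUnion L, ballUnion L), (∀ x, r x ∈ B) ∧
      Set.EqOn r (fun x => if x ∈ B then x else h (x, 1)) (B ∪ Q) := by
    refine ContinuousOn.exists_extension_of_mapsTo (hB.union hQ) ?_ ?_
    · refine ContinuousOn.union_of_isClosed ?_ ?_ hB hQ
      · exact continuousOn_id.congr fun x hx => if_pos hx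
      · refine ContinuousOn.congr (f := fun x => h (x, 1))
          (hc.comp (by fun_prop) fun x hx => ⟨hx, trivial⟩) fun x hx => ?_
        by_cases hxB : x ∈ B
        · exact (if_pos hxB).trans (hf x hx hxB).symm
        · exact if_neg hxB
    · intro x hx
      by_cases hxB : x ∈ B
      · simp [hxB]
      · simpa [hxB] using h1 x (hx.resolve_left hxB)
  have hrB : ∀ x ∈ B, r x = x := fun x hx => (hr2 (Or.inl hx)).trans (if_pos hx)
  have hrQ : ∀ x ∈ Q, r x = h (x, 1) := fun x hx => by
    by_cases hxB : x ∈ B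
    · rw [hrB x hxB, hf x hx hxB]
    · exact (hr2 (Or.inr hx)).trans (if_neg hxB)
  let f : ballUnion L × unitInterval → ballUnion L := fun q =>
    if q.2 = 0 then q.1 else if q.2 = 1 then r q.1 else h q
  have hfQ : ∀ q ∈ Q ×ˢ (Set.univ : Set unitInterval), f q = h q := by
    rintro ⟨x, s⟩ ⟨hx, -⟩
    simp only [f]
    split_ifs with e0 e1
    · rw [e0, h0 x hx]
    · rw [e1, hrQ x hx]
    · rfl
  have c0 : IsClosed {q : ballUnion L × unitInterval | q.2 = 0} :=
    isClosed_eq continuous_snd continuous_const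
  have c1 : IsClosed {q : ballUnion L × unitInterval | q.2 = 1} :=
    isClosed_eq continuous_snd continuous_const
  have hfc : ContinuousOn f
      (({q | q.2 = 0} ∪ {q | q.2 = 1}) ∪ Q ×ˢ (Set.univ : Set unitInterval)) := by
    refine ContinuousOn.union_of_isClosed (ContinuousOn.union_of_isClosed ?_ ?_ c0 c1)
      (hc.congr hfQ) (c0.union c1) (hQ.prod isClosed_univ)
    · exact continuous_fst.continuousOn.congr fun q hq => if_pos hq
    · refine (r.continuous.comp continuous_fst).continuousOn.congr fun q hq => ?_
      have hq' : q.2 = 1 := hq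
      simp [f, hq']
  obtain ⟨H, hH⟩ := exists_extension_ballUnion ((c0.union c1).union (hQ.prod isClosed_univ)) hfc
  have hH1 : ∀ x, H (x, 1) = r x := fun x => (hH (Or.inl (Or.inr rfl))).trans (by simp [f])
  refine ⟨H, ⟨fun x => ?_, fun x => ?_, fun x hx => ?_⟩, fun x hx s => ?_⟩
  · exact (hH (Or.inl (Or.inl rfl))).trans (by simp [f])
  · rw [hH1]; exact hr1 x
  · rw [hH1, hrB x hx]
  · exact (hH (Or.inr ⟨hx, trivial⟩)).trans (hfQ _ ⟨hx, trivial⟩)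

end Extension

/-! ### Finiteness of compact CW complexes. -/

namespace CellStructure

/-- A CW complex that is compact has finitely many cells. -/
lemma IsCW.finite {X Λ : Type} [TopologicalSpace X] [CompactSpace X] [T1Space X]
    {σ : CellStructure X Λ} (h : σ.IsCW) (hne : ∀ l, (σ.stratum l).Nonempty) : Finite Λ := by
  choose x hx using hne
  have hx' : ∀ l, σ.strat (x l) = l := hx
  have hinj : Function.Injective x := fun a b e => by rw [← hx' a, e, hx' b]
  -- With one point per cell, any set of chosen points meets each closed cell in a finite set. The
  -- chosen points are thus closed and discrete in a compact space.
  have hcl : ∀ S : Set X, S ⊆ Set.range x → IsClosed S := by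
    intro S hS
    refine h.weakTopology S fun l => Set.Finite.isClosed ?_
    obtain ⟨F, hF⟩ := h.closureFinite l
    refine ((F.finite_toSet.insert l).image x).subset ?_
    rintro y ⟨hy, hyl⟩
    obtain ⟨m, rfl⟩ := hS hy
    refine ⟨m, ?_, rfl⟩
    by_cases hm : m = l
    · exact Or.inl hm
    · obtain ⟨p, hp⟩ := Set.mem_iUnion.1 (hF ⟨hyl, fun e => hm ((hx' m).symm.trans e)⟩)
      obtain ⟨hpF, hp⟩ := Set.mem_iUnion.1 hp
      have : p = m := hp.symm.trans (hx' m)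
      exact Or.inr (this ▸ hpF)
  have hd : DiscreteTopology (Set.range x) := by
    refine discreteTopology_iff_forall_isClosed.2 fun T => ?_
    rw [← Set.preimage_image_eq T Subtype.val_injective]
    exact (hcl _ (by rintro _ ⟨y, -, rfl⟩; exact y.2)).preimage continuous_subtype_val
  have hc : CompactSpace (Set.range x) :=
    isCompact_iff_compactSpace.1 (hcl _ subset_rfl).isCompact
  have hf : Finite (Set.range x) := finite_of_compact_of_discrete
  exact (Equiv.ofInjective x hinj).finite_iff.2 hf

end CellStructure

/-! ### Comparison of `L` with `K`. -/

section BallUnion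

variable {n : ℕ} {L : Set (Metric.sphere (0 : EuclideanSpace ℝ (Fin n)) 1)}

lemma norm_ballUnionIncl (y : L) : ‖(ballUnionIncl L y : EuclideanSpace ℝ (Fin n))‖ = 1 :=
  mem_sphere_zero_iff_norm.1 y.1.2

lemma mem_range_ballUnionIncl {x : ballUnion L} :
    x ∈ Set.range (ballUnionIncl L) ↔ ‖(x : EuclideanSpace ℝ (Fin n))‖ = 1 := by
  constructor
  · rintro ⟨y, rfl⟩
    exact norm_ballUnionIncl y
  · intro hx
    rcases x.2 with h | ⟨y, hy, e⟩
    · rw [mem_ball_zero_iff] at h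
      exact absurd hx h.ne
    · exact ⟨⟨y, hy⟩, Subtype.ext e⟩

lemma isClosedEmbedding_ballUnionIncl : IsClosedEmbedding (ballUnionIncl L) where
  toIsEmbedding := by
    have h : IsEmbedding (Subtype.val ∘ Subtype.val : L → EuclideanSpace ℝ (Fin n)) :=
      IsEmbedding.subtypeVal.comp IsEmbedding.subtypeVal
    exact .of_comp (map_continuous _) continuous_subtype_val h
  isClosed_range := by
    have : Set.range (ballUnionIncl L) =
        {x : ballUnion L | ‖(x : EuclideanSpace ℝ (Fin n))‖ = 1} := by
      ext x
      exact mem_range_ballUnionIncl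
    rw [this]
    exact isClosed_eq (by fun_prop) continuous_const

namespace CellStructure

variable {M : Type} (τ : CellStructure L M)

lemma strat_addBall_incl (y : L) : τ.addBall.strat (ballUnionIncl L y) = (τ.strat y : WithTop M) := by
  have h : ∃ y', ballUnionIncl L y' = ballUnionIncl L y := ⟨y, rfl⟩
  refine (dif_pos h).trans ?_
  rw [isClosedEmbedding_ballUnionIncl.injective h.choose_spec]

lemma stratum_addBall_coe (m : M) :
    τ.addBall.stratum m = ballUnionIncl L '' τ.stratum m := by
  ext x
  constructor
  · intro hx
    have hx' : τ.addBall.strat x = m := hx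
    by_cases h : ∃ y, ballUnionIncl L y = x
    · obtain ⟨y, rfl⟩ := h
      rw [strat_addBall_incl] at hx'
      exact ⟨y, WithTop.coe_injective hx', rfl⟩
    · exact absurd ((dif_neg h).symm.trans hx') WithTop.top_ne_coe
  · rintro ⟨y, hy, rfl⟩
    have hy' : τ.strat y = m := hy
    exact (strat_addBall_incl τ y).trans (congrArg _ hy')

lemma mem_stratum_addBall_top {x : ballUnion L} :
    x ∈ τ.addBall.stratum ⊤ ↔ ‖(x : EuclideanSpace ℝ (Fin n))‖ < 1 := by
  have hle : ‖(x : EuclideanSpace ℝ (Fin n))‖ ≤ 1 := by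
    simpa using ballUnion_subset_closedBall x.2
  rw [hle.lt_iff_ne, ne_eq, ← mem_range_ballUnionIncl]
  constructor
  · rintro hx ⟨y, rfl⟩
    exact WithTop.coe_ne_top ((strat_addBall_incl τ y).symm.trans hx)
  · exact fun h => dif_neg h

lemma RegularFaces.addBall [PartialOrder M] {τ : CellStructure L M} (hτ : τ.RegularFaces) :
    τ.addBall.RegularFaces where
  isEmbedding_char
    | ⊤ => IsEmbedding.id
    | (m : M) => isClosedEmbedding_ballUnionIncl.isEmbedding.comp (hτ.isEmbedding_char m)
  image_interior
    | ⊤ => by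
      ext x
      rw [mem_stratum_addBall_top]
      constructor
      · rintro ⟨y, hy, rfl⟩
        exact mem_ball_zero_iff.1 hy
      · intro hx
        exact ⟨x, mem_ball_zero_iff.2 hx, rfl⟩
    | (m : M) => by
      rw [stratum_addBall_coe, ← hτ.image_interior, Set.image_image]
      rfl
  le_iff
    | l, ⊤ => iff_of_true le_top fun x _ => ⟨x, rfl⟩
    | ⊤, (m : M) => by
      refine iff_of_false (WithTop.not_top_le_coe m) fun h => ?_
      have h0 : (0 : EuclideanSpace ℝ (Fin n)) ∈ ballUnion L :=
        Or.inl (Metric.mem_ball_self one_pos)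
      obtain ⟨y, hy⟩ := h ⟨⟨0, h0⟩, rfl⟩
      have h1 := norm_ballUnionIncl ((τ.cell m).char y)
      have h2 := (congrArg (fun x : ballUnion L => ‖(x : EuclideanSpace ℝ (Fin n))‖) hy).symm.trans h1
      exact zero_ne_one (norm_zero.symm.trans h2)
    | (l : M), (m : M) => by
      rw [WithTop.coe_le_coe, hτ.le_iff]
      exact (Set.image_subset_image_iff isClosedEmbedding_ballUnionIncl.injective).symm.trans
        (by rw [← Set.range_comp, ← Set.range_comp]; rfl)
  disjoint
    | ⊤, m, h => absurd h not_top_lt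
    | (l : M), ⊤, _ => by
      rw [Set.disjoint_left]
      rintro _ ⟨y, rfl⟩ hx
      rw [mem_stratum_addBall_top] at hx
      exact hx.ne (norm_ballUnionIncl ((τ.cell l).char y))
    | (l : M), (m : M), h => by
      rw [stratum_addBall_coe]
      have := (Set.disjoint_image_iff isClosedEmbedding_ballUnionIncl.injective).2
        (hτ.disjoint l m (WithTop.coe_lt_coe.1 h))
      rwa [← Set.range_comp] at this

lemma ConePoint.addBall [PartialOrder M] {τ : CellStructure L M} {m : M} {c : M → ℝ}
    {z : (τ.cell m).domain} (h : τ.ConePoint m c z) :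
    ∃ c', τ.addBall.ConePoint (m : WithTop M) c' z := by
  induction h with
  | base m => exact ⟨_, ConePoint.base (σ := τ.addBall) (m : WithTop M)⟩
  | @step l m h b r c z hz ih =>
    obtain ⟨c', ih⟩ := ih
    let b' : StratCell.Lift (τ.addBall.cell l) (τ.addBall.cell m) :=
      ⟨b.map, fun x => congrArg (ballUnionIncl L) (b.comm x)⟩
    exact ⟨_, ConePoint.step (σ := τ.addBall) (WithTop.coe_lt_coe.2 h) b' r ih⟩

/-- Indices below a cell of `L` are never `⊤`, so the whole construction takes place in `L`. The
index is a variable with an equation so that the induction can run. -/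
lemma ConePoint.of_addBall [PartialOrder M] {τ : CellStructure L M} {p : WithTop M}
    {c : WithTop M → ℝ} {z : (τ.addBall.cell p).domain} (h : τ.addBall.ConePoint p c z) :
    ∀ (m : M) (hp : p = m), ∃ c', τ.ConePoint m c' (hp ▸ z : (τ.addBall.cell m).domain) := by
  induction h with
  | base p =>
    rintro m rfl
    exact ⟨_, ConePoint.base m⟩
  | @step l p h b r c z hz ih =>
    rintro m rfl
    obtain ⟨l', rfl⟩ := WithTop.ne_top_iff_exists.1 (h.trans_le le_top).ne
    obtain ⟨c', ih⟩ := ih l' rfl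
    let b' : StratCell.Lift (τ.cell l') (τ.cell m) :=
      ⟨b.map, fun x => isClosedEmbedding_ballUnionIncl.injective (b.comm x)⟩
    exact ⟨_, ConePoint.step (WithTop.coe_lt_coe.1 h) b' r ih⟩

/-- A proper cone point lies in the stratum of its index; if it lies on the sphere, that index is a
cell of `L`, and it is a cone point there. -/
lemma ballUnionIncl_mem_range_sdMap_iff [PartialOrder M] [Finite M] {τ : CellStructure L M}
    (hτ : τ.RegularFaces) (y : L) :
    ballUnionIncl L y ∈ Set.range τ.addBall.sdMap ↔ y ∈ Set.range τ.sdMap := by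
  rw [hτ.range_sdMap_eq, hτ.addBall.range_sdMap_eq]
  constructor
  · rintro ⟨p, c, z, h, e⟩
    obtain ⟨q, -, z', h', e'⟩ := hτ.addBall.exists_proper h
    have hq := hτ.addBall.strat_char h'.norm_lt
    rw [e', e, strat_addBall_incl] at hq
    subst hq
    obtain ⟨c', h''⟩ := h'.conePoint.of_addBall _ rfl
    exact ⟨_, c', z', h'', isClosedEmbedding_ballUnionIncl.injective (e'.trans e)⟩
  · rintro ⟨m, c, z, h, rfl⟩
    obtain ⟨c', h'⟩ := h.addBall
    exact ⟨m, c', z, h', rfl⟩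

end CellStructure

end BallUnion

theorem mainTheorem7 (n : ℕ) {Λ M : Type} [PartialOrder Λ] [PartialOrder M]
    (σ : CellStructure (Metric.sphere (0 : EuclideanSpace ℝ (Fin n)) 1) Λ)
    (hσ : σ.IsRegularCellComplex)
    (L : Set (Metric.sphere (0 : EuclideanSpace ℝ (Fin n)) 1))
    (τ : CellStructure L M) (hτ : τ.IsCellularStratification) (hreg : τ.IsRegular)
    (hL : τ.IsStratifiedSubspace σ) :
    (∃ H : C(ballUnion L × unitInterval, ballUnion L),
      IsStrongDeformationRetraction (Set.range τ.addBall.sdMap) H) ∧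
    (∀ h : C(L × unitInterval, L), IsDeformationRetraction (Set.range τ.sdMap) h →
      ∃ H : C(ballUnion L × unitInterval, ballUnion L),
        IsDeformationRetraction (Set.range τ.addBall.sdMap) H ∧
        ∀ y s, H (ballUnionIncl L y, s) = ballUnionIncl L (h (y, s))) ∧
    (∀ h : C(L × unitInterval, L), IsStrongDeformationRetraction (Set.range τ.sdMap) h →
      ∃ H : C(ballUnion L × unitInterval, ballUnion L),
        IsStrongDeformationRetraction (Set.range τ.addBall.sdMap) H ∧
        ∀ y s, H (ballUnionIncl L y, s) = ballUnionIncl L (h (y, s))) := by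
  have hΛ : Finite Λ := hσ.isCW.finite fun l => (hσ.isCellularStratification.connected l).nonempty
  have hM : Finite M := by
    obtain ⟨f, hf, hf', -⟩ := hL
    refine Finite.of_injective f fun a b e => ?_
    obtain ⟨y, hy⟩ := (hτ.connected a).nonempty
    have h1 : y.1 ∈ Subtype.val '' τ.stratum b := by
      rw [hf', ← e, ← hf']
      exact ⟨y, hy, rfl⟩
    obtain ⟨y', hy', e'⟩ := h1
    obtain rfl : y' = y := Subtype.ext e'
    exact hy.symm.trans hy'
  have hF := hτ.regularFaces hreg
  have hB : IsClosed (Set.range τ.addBall.sdMap) := hF.addBall.isCompact_range_sdMap.isClosed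
  have hT := hF.addBall.tietzeExtension_range_sdMap
  have hmem := CellStructure.ballUnionIncl_mem_range_sdMap_iff hF
  have hi := isClosedEmbedding_ballUnionIncl (L := L)
  classical
  -- Off `L` the default is the stationary homotopy, which is what the strong case needs on `B \ L`.
  let ext (h : C(L × unitInterval, L)) (q : ballUnion L × unitInterval) : ballUnion L :=
    if hq : ∃ y, ballUnionIncl L y = q.1 then ballUnionIncl L (h (hq.choose, q.2)) else q.1
  have ext_incl : ∀ h y s, ext h (ballUnionIncl L y, s) = ballUnionIncl L (h (y, s)) := by
    intro h y s
    have hq : ∃ y', ballUnionIncl L y' = ballUnionIncl L y := ⟨y, rfl⟩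
    refine (dif_pos hq).trans ?_
    rw [hi.injective hq.choose_spec]
  have ext_cont : ∀ h, ContinuousOn (ext h) (Set.range (ballUnionIncl L) ×ˢ Set.univ) := by
    intro h
    have hind : IsInducing (Prod.map (ballUnionIncl L) (id : unitInterval → unitInterval)) :=
      hi.isInducing.prodMap IsInducing.id
    have := (hind.continuousOn_image_iff (g := ext h) (s := Set.univ)).2 (by
      rw [continuousOn_univ]
      refine Continuous.congr (f := fun q => ballUnionIncl L (h q)) (by fun_prop) ?_
      rintro ⟨y, s⟩
      exact (ext_incl h y s).symm)
    rwa [Set.image_univ, Set.range_prodMap, Set.range_id] at this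
  refine ⟨?_, fun h hh => ?_, fun h hh => ?_⟩
  -- Here `Q = B` with the stationary homotopy, so the extension is automatically strong.
  · obtain ⟨H, hH, hHB⟩ := exists_isDeformationRetraction_extension hB hB (fun q => q.1)
      continuous_fst.continuousOn (fun _ _ => rfl) (fun _ hx => hx) (fun _ _ _ => rfl)
    exact ⟨H, ⟨hH, hHB⟩⟩
  · obtain ⟨H, hH, hHL⟩ := exists_isDeformationRetraction_extension hB hi.isClosed_range (ext h)
      (ext_cont h) (by
        rintro _ ⟨y, rfl⟩
        rw [ext_incl, hh.map_zero]) (by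
        rintro _ ⟨y, rfl⟩
        rw [ext_incl, hmem]
        exact hh.map_one_mem y) (by
        rintro _ ⟨y, rfl⟩ hy
        rw [ext_incl, hh.map_one y ((hmem y).1 hy)])
    exact ⟨H, hH, fun y s => (hHL _ ⟨y, rfl⟩ s).trans (ext_incl h y s)⟩
  · have hfix : ∀ x ∈ Set.range τ.addBall.sdMap, ∀ s, ext h (x, s) = x := by
      intro x hx s
      by_cases hxL : x ∈ Set.range (ballUnionIncl L)
      · obtain ⟨y, rfl⟩ := hxL
        rw [ext_incl, hh.fixed y ((hmem y).1 hx)]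
      · exact dif_neg hxL
    -- Here `Q = L ∪ B`: strongness of `h` makes it stationary on `L ∩ B`, so the two prescriptions
    -- glue.
    obtain ⟨H, hH, hHL⟩ := exists_isDeformationRetraction_extension hB (hi.isClosed_range.union hB)
      (ext h) (by
        rw [Set.union_prod]
        refine (ext_cont h).union_of_isClosed ?_ (hi.isClosed_range.prod isClosed_univ)
          (hB.prod isClosed_univ)
        exact continuous_fst.continuousOn.congr fun q hq => hfix q.1 hq.1 q.2) (by
        rintro _ (⟨y, rfl⟩ | hx)
        · rw [ext_incl, hh.map_zero]
        · exact hfix _ hx 0) (by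
        rintro _ (⟨y, rfl⟩ | hx)
        · rw [ext_incl, hmem]
          exact hh.map_one_mem y
        · rw [hfix _ hx]
          exact hx) (fun x _ hx => hfix x hx 1)
    exact ⟨H, ⟨hH, fun x hx s => (hHL x (Or.inr hx) s).trans (hfix x hx s)⟩,
      fun y s => (hHL _ (Or.inl ⟨y, rfl⟩) s).trans (ext_incl h y s)⟩
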